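/- Let $\mathcal{O}_K$ be a Henselian discrete valuation ring with fraction field $K$ of characteristic $0$ and algebraically closed residue field of characteristic $2$. Let $v$ be the normalized valuation of $K$, with the convention $v(0)=\infty$. Let $E_1/K$ and $E_2/K$ be elliptic curves with $j$-invariants $j_1$ and $j_2$, and assume that there is an isogeny $E_1\to E_2$ of degree $2$ defined over $K$. Then: (i) If $v(j_1)=v(j_2)>0$, then $v(j_1)=v(j_2)=6v(2)$. (ii) If $0<v(j_1)<v(j_2)$, then $v(j_1)<6v(2)$. Moreover: (a) if $v(j_1)<4v(2)$, then $v(j_2)=2v(j_1)$; (b) if $4v(2)<v(j_1)<6v(2)$, then $v(j_2)=12v(2)-v(j_1)$; (c) if $v(j_1)=4v(2)$ and $j_2\neq 0$, then $v(j_2)=8v(2)+3r$ for some integer $r\ge 0$. (iii) Assume that $K=\mathbb{Q}_2^{\mathrm{unr}}$ is the maximal unramified extension of $\mathbb{Q}_2$, that $j_1,j_2\in\mathbb{Q}_2\subset K$, that $v(j_1)=4v(2)<v(j_2)$, and that $j_2\ne 0$. Then $v(j_2)=8v(2)+3r$ for some integer $r\ge 1$. -/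

import Mathlib

open WeierstrassCurve

/-- The normalized additive valuation `v` on the fraction field `K` of a discrete valuation ring
`O`, with values in `ℤ ∪ {∞}`: a uniformizer has valuation `1`, and `v 0 = ∞`. Mathlib's
multiplicative valuation sends a uniformizer to `exp (-1)`, whence the sign. -/
noncomputable def normVal (O : Type*) {K : Type*} [CommRing O] [IsDomain O]
    [IsDiscreteValuationRing O] [Field K] [Algebra O K] [IsFractionRing O K] (x : K) :
    WithTop ℤ :=
  open Classical in
  if x = 0 then ⊤
  else ((-(WithZero.log ((IsDiscreteValuationRing.maximalIdeal O).valuation K x)) : ℤ) :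
    WithTop ℤ)

namespace EllipticIsogeny

variable {K : Type*} [Field K]

/-- The geometric points `E(K̄)`, where `K̄` is an algebraic closure of `K`. -/
abbrev GeomPoint (E : WeierstrassCurve K) : Type _ :=
  (E.baseChange (AlgebraicClosure K)).toAffine.Point

/-- Homogeneous coordinates of a geometric point in the projective plane: the point at infinity
is `[0 : 1 : 0]`, and the affine point `(x, y)` is `[x : y : 1]`. -/
noncomputable def coords {E : WeierstrassCurve K} : GeomPoint E → Fin 3 → AlgebraicClosure K
  | .zero => ![0, 1, 0]
  | .some x y _ => ![x, y, 1]

/-- The coordinate function `x` in the function field `K(E)`. -/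
noncomputable def xFun (E : WeierstrassCurve K) : E.toAffine.FunctionField :=
  algebraMap E.toAffine.CoordinateRing E.toAffine.FunctionField
    (Affine.CoordinateRing.mk E.toAffine (Polynomial.C Polynomial.X))

/-- The coordinate function `y` in the function field `K(E)`. -/
noncomputable def yFun (E : WeierstrassCurve K) : E.toAffine.FunctionField :=
  algebraMap E.toAffine.CoordinateRing E.toAffine.FunctionField
    (Affine.CoordinateRing.mk E.toAffine Polynomial.X)

open Classical in
/-- An isogeny `E₁ → E₂` of elliptic curves over a field `K`: a non-constant morphism of curves
over `K` that is a homomorphism for the group laws. It consists of the homomorphism on geometric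
points and of the corresponding `K`-embedding of function fields. That these come from
a morphism of projective curves defined over `K` is expressed by `regular`: near each geometric
point `P` of `E₁` both are given by one triple `[F₀ : F₁ : F₂]` of homogeneous polynomials of the
same degree with coefficients in `K` that do not all vanish at `P`. -/
structure Isogeny (E₁ E₂ : WeierstrassCurve K) where
  /-- The homomorphism `E₁(K̄) → E₂(K̄)`. -/
  toHom : GeomPoint E₁ →+ GeomPoint E₂
  /-- The embedding `K(E₂) → K(E₁)`, `f ↦ f ∘ φ`. -/
  pullback : E₂.toAffine.FunctionField →ₐ[K] E₁.toAffine.FunctionField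
  regular : ∀ P : GeomPoint E₁, ∃ (n : ℕ) (F : Fin 3 → MvPolynomial (Fin 3) K),
    (∀ i, (F i).IsHomogeneous n) ∧
    (∃ i, MvPolynomial.aeval (coords P) (F i) ≠ 0) ∧
    (∀ Q : GeomPoint E₁, ∃ c : AlgebraicClosure K,
      ∀ i, MvPolynomial.aeval (coords Q) (F i) = c * coords (toHom Q) i) ∧
    ∃ c : E₁.toAffine.FunctionField,
      ∀ i, MvPolynomial.aeval ![xFun E₁, yFun E₁, 1] (F i) =
        c * ![pullback (xFun E₂), pullback (yFun E₂), 1] i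

/-- The degree of an isogeny: the degree of the extension of function fields
`K(E₁) / φ^* K(E₂)`. -/
noncomputable def Isogeny.degree {E₁ E₂ : WeierstrassCurve K} (φ : Isogeny E₁ E₂) : ℕ :=
  Module.finrank φ.pullback.fieldRange E₁.toAffine.FunctionField

end EllipticIsogeny

/-- The maximal unramified extension `ℚ₂^unr` of `ℚ₂` (inside a fixed algebraic closure): the
compositum of all finite extensions of `ℚ₂` whose ring of integers is unramified over `ℤ₂`. -/
noncomputable def maxUnramified : IntermediateField ℚ_[2] (AlgebraicClosure ℚ_[2]) :=
  sSup {L | FiniteDimensional ℚ_[2] L ∧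
    Algebra.FormallyUnramified ℤ_[2] (integralClosure ℤ_[2] L)}

/-! The two `j`-invariants are governed by one parameter `h`, the Hauptmodul of `X₀(2)`: `j₁ h = (h
+ 16)³` and `j₂ h² = (h + 256)³`. Once such an `h ≠ 0` exists in `K` (`exists_hauptmodul`), the
valuations follow from the ultrametric inequality.

To find `h`, the isogeny is turned into polynomials. It commutes with negation, so `φ^* x` is a
rational function `P / d` of `x`, while the pullback of `ψ₂ = 2y + a₁x + a₃` is `ψ₂` times such a
function; moreover `deg P > deg d`, because the origin goes to the origin (`exists_rational_form`).
In lowest terms `P / d = N / Q`, and comparing field degrees (`natDegree_eq_degree`) gives `deg N =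
2` and `deg Q ≤ 1`. The equation of `E₂`, pulled back, says that the two-division cubic of `E₁` and
the homogenized one of `E₂` at `(N, Q)` agree up to squares and a factor `Q`. Parity of root
multiplicities then shows that `Q` vanishes at a 2-torsion abscissa and determines the cubic of `E₂`
(`symmetric_functions_of_mul_sq_eq`), so Vélu's formulas are never needed.

Let `e = v(2)` and `m = v(h)`. Away from `m = 4e` and `m = 8e` respectively, `v(j₁) = 3 min(m, 4e) -
m` and `v(j₂) = 3 min(m, 8e) - 2m`, which gives (i), (a) and (b) by linear arithmetic. Case (c) is
`m = 8e`, where `v(j₂) = 3 v(h + 256) - 16e` and `v(h + 256) ≥ 8e`. For (iii), put `h = 256 t`: then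
`(j₁ / 16) t = (16 t + 1)³` and `j₁ / 16` is a unit of `ℤ₂`, hence congruent to `1`. So `t ≡ 1 ≡ -1`
and `v(h + 256) > 8e`. -/

/-! ### Polynomials that agree up to squares -/

open Polynomial in
-- Parity: the multiplicity of `γ` on the right is odd, so it cannot come from `t ^ 2` alone.
lemma Polynomial.eval_eq_zero_of_mul_sq_eq {F : Type*} [Field F] {u t g v : F[X]} {γ : F}
    (h : u * t ^ 2 = g ^ 2 * ((X - C γ) * v)) (hg : g ≠ 0) (hv : v.eval γ ≠ 0) :
    u.eval γ = 0 := by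
  by_contra hu
  have hv0 : v ≠ 0 := fun h0 => hv (by simp [h0])
  have hu0 : u ≠ 0 := fun h0 => hu (by simp [h0])
  have hX := X_sub_C_ne_zero γ
  have hR : g ^ 2 * ((X - C γ) * v) ≠ 0 := by positivity
  have ht : t ≠ 0 := by
    rintro rfl
    exact hR (by rw [← h]; simp)
  have h1 := congrArg (rootMultiplicity γ) h
  rw [rootMultiplicity_mul (by positivity), rootMultiplicity_mul hR,
    rootMultiplicity_mul (by positivity), rootMultiplicity_eq_zero hu, rootMultiplicity_eq_zero hv,
    rootMultiplicity_X_sub_C_self, sq, sq, rootMultiplicity_mul (by positivity),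
    rootMultiplicity_mul (by positivity)] at h1
  omega

open Polynomial in
/-- A separable quadratic whose roots have odd multiplicity in `(X² + aX + b) t²` is proportional
to `X² + aX + b`. -/
lemma quadratic_eq_of_mul_sq_eq {F : Type*} [Field F] [IsAlgClosed F] [CharZero F]
    {c e g a b : F} {t G V : F[X]} (hc : c ≠ 0) (hdisc : e ^ 2 - 4 * c * g ≠ 0) (hG : G ≠ 0)
    (h : (X ^ 2 + C a * X + C b) * t ^ 2 =
      G ^ 2 * ((C c * X ^ 2 + C e * X + C g) * V))
    (hV : ∀ γ, c * γ ^ 2 + e * γ + g = 0 → V.eval γ ≠ 0) : e = c * a ∧ g = c * b := by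
  obtain ⟨s, hs⟩ := IsAlgClosed.exists_pow_nat_eq (e ^ 2 - 4 * c * g) two_pos
  have hs0 : s ≠ 0 := by rintro rfl; simp at hs; exact hdisc hs.symm
  obtain ⟨p, hp⟩ : ∃ p, p = (-e + s) / (2 * c) := ⟨_, rfl⟩
  obtain ⟨q, hq⟩ : ∃ q, q = (-e - s) / (2 * c) := ⟨_, rfl⟩
  have he : e = - c * (p + q) := by rw [hp, hq]; field_simp; ring
  have hg : g = c * (p * q) := by
    rw [hp, hq]; field_simp; linear_combination hs
  have hpq : p - q ≠ 0 := by
    have : p - q = s / c := by rw [hp, hq]; field_simp; ring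
    rw [this]; positivity
  have key : ∀ p q, e = - c * (p + q) → g = c * (p * q) → p - q ≠ 0 →
      p ^ 2 + a * p + b = 0 := by
    intro p q he hg hpq
    have := Polynomial.eval_eq_zero_of_mul_sq_eq (γ := p) (u := X ^ 2 + C a * X + C b)
      (t := t) (g := G) (v := C c * (X - C q) * V) (by
        rw [h, he, hg]; simp only [map_mul, map_neg, map_add]; ring) hG (by
        have := hV p (by rw [he, hg]; ring)
        simp [hc, hpq, this])
    simpa using this
  have h1 := key p q he hg hpq
  have h2 := key q p (by rw [he]; ring) (by rw [hg]; ring)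
    (by intro h0; apply hpq; linear_combination -h0)
  have ha : a = -(p + q) := by
    apply mul_left_cancel₀ hpq; linear_combination h1 - h2
  have hb : b = p * q := by linear_combination h1 - p * ha
  exact ⟨by rw [he, ha]; ring, by rw [hg, hb]⟩

open Polynomial in
/-- If `4 ∏ (cz² + dz + g - rᵢ z)` agrees with `4 (z² + az + b)` up to squares, then the `rᵢ` are
`d - ca` and `d ± 2c√b`. -/
lemma symmetric_functions_of_mul_sq_eq {F : Type*} [Field F] [IsAlgClosed F] [CharZero F]
    {c d g a b r₁ r₂ r₃ : F} {t G : F[X]} (hc : c ≠ 0) (hg : g ≠ 0) (hG : G ≠ 0)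
    (h12 : r₁ ≠ r₂) (h13 : r₁ ≠ r₃) (h23 : r₂ ≠ r₃)
    (h : (X ^ 2 + C a * X + C b) * t ^ 2 = G ^ 2 *
      ((C c * X ^ 2 + C (d - r₁) * X + C g) * (C c * X ^ 2 + C (d - r₂) * X + C g) *
        (C c * X ^ 2 + C (d - r₃) * X + C g))) :
    g = c * b ∧ r₁ + r₂ + r₃ = 3 * d - c * a ∧
      r₁ * r₂ + r₁ * r₃ + r₂ * r₃ = 2 * d * (d - c * a) + d ^ 2 - 4 * c ^ 2 * b ∧
      r₁ * r₂ * r₃ = (d - c * a) * (d ^ 2 - 4 * c ^ 2 * b) := by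
  have key : ∀ r s t' : F, r ≠ s → r ≠ t' → (X ^ 2 + C a * X + C b) * t ^ 2 = G ^ 2 *
      ((C c * X ^ 2 + C (d - r) * X + C g) * ((C c * X ^ 2 + C (d - s) * X + C g) *
        (C c * X ^ 2 + C (d - t') * X + C g))) → (d - r) ^ 2 - 4 * c * g = 0 ∨
        (d - r = c * a ∧ g = c * b) := by
    intro r s t' hs ht h
    by_cases h0 : (d - r) ^ 2 - 4 * c * g = 0
    · exact Or.inl h0
    · refine Or.inr (quadratic_eq_of_mul_sq_eq hc h0 hG h ?_)
      intro γ hγ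
      -- Two of the three quadratics differ by a nonzero multiple of `X`, so they can share only the
      -- root `0`, which `g ≠ 0` excludes.
      have hγ0 : γ ≠ 0 := by rintro rfl; simp at hγ; exact hg hγ
      have e1 : c * γ ^ 2 + (d - s) * γ + g = (r - s) * γ := by linear_combination hγ
      have e2 : c * γ ^ 2 + (d - t') * γ + g = (r - t') * γ := by linear_combination hγ
      simp only [eval_mul, eval_add, eval_C, eval_pow, eval_X, e1, e2]
      have := sub_ne_zero.2 hs
      have := sub_ne_zero.2 ht
      positivity
  have fin : ∀ r s t' : F, s ≠ t' → g = c * b → d - r = c * a → (d - s) ^ 2 - 4 * c * g = 0 →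
      (d - t') ^ 2 - 4 * c * g = 0 → s + t' = 2 * d ∧ s * t' = d ^ 2 - 4 * c ^ 2 * b := by
    intro r s t' hst hb hr h1 h2
    have e : s + t' = 2 * d := by
      apply mul_left_cancel₀ (sub_ne_zero.2 hst); linear_combination h1 - h2
    refine ⟨e, ?_⟩
    linear_combination -h1 + s * e - 4 * c * hb
  have k1 := key r₁ r₂ r₃ h12 h13 (by rw [h]; ring)
  have k2 := key r₂ r₁ r₃ h12.symm h23 (by rw [h]; ring)
  have k3 := key r₃ r₁ r₂ h13.symm h23.symm (by rw [h]; ring)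
  -- `(d - r)² = 4cg` has at most two solutions `r` and `d - r = ca` only one. So exactly two of the
  -- distinct `rᵢ` satisfy the former, and five of the eight cases are contradictory.
  rcases k1 with k1 | ⟨k1, kg⟩ <;> rcases k2 with k2 | ⟨k2, kg⟩ <;>
    rcases k3 with k3 | ⟨k3, kg⟩
  · exfalso
    have e1 : r₁ + r₂ = 2 * d := by
      apply mul_left_cancel₀ (sub_ne_zero.2 h12); linear_combination k1 - k2
    have e2 : r₁ + r₃ = 2 * d := by
      apply mul_left_cancel₀ (sub_ne_zero.2 h13); linear_combination k1 - k3
    exact h23 (by linear_combination e1 - e2)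
  · obtain ⟨e1, e2⟩ := fin _ _ _ h12 kg k3 k1 k2
    refine ⟨kg, by linear_combination e1 - k3, ?_, ?_⟩
    · linear_combination e2 + r₃ * e1 - 2 * d * k3
    · linear_combination r₃ * e2 - (d ^ 2 - 4 * c ^ 2 * b) * k3
  · obtain ⟨e1, e2⟩ := fin _ _ _ h13 kg k2 k1 k3
    refine ⟨kg, by linear_combination e1 - k2, ?_, ?_⟩
    · linear_combination e2 + r₂ * e1 - 2 * d * k2
    · linear_combination r₂ * e2 - (d ^ 2 - 4 * c ^ 2 * b) * k2
  · exact absurd (by linear_combination k3 - k2) h23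
  · obtain ⟨e1, e2⟩ := fin _ _ _ h23 kg k1 k2 k3
    refine ⟨kg, by linear_combination e1 - k1, ?_, ?_⟩
    · linear_combination e2 + r₁ * e1 - 2 * d * k1
    · linear_combination r₁ * e2 - (d ^ 2 - 4 * c ^ 2 * b) * k1
  · exact absurd (by linear_combination k3 - k1) h13
  · exact absurd (by linear_combination k2 - k1) h12
  · exact absurd (by linear_combination k2 - k1) h12

/-! ### From the polynomial relation to the Hauptmodul -/

lemma WeierstrassCurve.j_mul_Δ {K : Type*} [Field K] (E : WeierstrassCurve K) [E.IsElliptic] :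
    E.j * E.Δ = E.c₄ ^ 3 := by
  have h : E.Δ ≠ 0 := E.isUnit_Δ.ne_zero
  rw [j, Units.val_inv_eq_inv_val, coe_Δ']
  field_simp

lemma WeierstrassCurve.four_mul_Δ {K : Type*} [Field K] (E : WeierstrassCurve K) :
    4 * E.Δ = -E.b₂ ^ 2 * (E.b₂ * E.b₆ - E.b₄ ^ 2) - 32 * E.b₄ ^ 3 - 108 * E.b₆ ^ 2 +
      36 * E.b₂ * E.b₄ * E.b₆ := by
  rw [Δ]; linear_combination -E.b₂ ^ 2 * E.b_relation

/-- The `j`-invariants of `y² = x(x² + ax + b)` and of its quotient by `(0, 0)`, in terms of the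
Hauptmodul `16 (a² - 4b) / b` of `X₀(2)`. -/
lemma j_eq_of_two_torsion_form {K : Type*} [Field K] [CharZero K] (E₁ E₂ : WeierstrassCurve K)
    [E₁.IsElliptic] [E₂.IsElliptic] {x₀ a b c d : K} (hb : b ≠ 0) (hc : c ≠ 0)
    (h2 : E₁.b₂ = 4 * a - 12 * x₀) (h4 : E₁.b₄ = 2 * b - 6 * x₀ ^ 2 - E₁.b₂ * x₀)
    (h6 : E₁.b₆ = -(4 * x₀ ^ 3 + E₁.b₂ * x₀ ^ 2 + 2 * E₁.b₄ * x₀))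
    (h2' : E₂.b₂ = -4 * (3 * d - c * a))
    (h4' : E₂.b₄ = 2 * (2 * d * (d - c * a) + d ^ 2 - 4 * c ^ 2 * b))
    (h6' : E₂.b₆ = -4 * ((d - c * a) * (d ^ 2 - 4 * c ^ 2 * b))) :
    ∃ h : K, h ≠ 0 ∧ E₁.j * h = (h + 16) ^ 3 ∧ E₂.j * h ^ 2 = (h + 256) ^ 3 := by
  rw [h2] at h4
  rw [h4, h2] at h6
  have hD1 : E₁.Δ = 16 * b ^ 2 * (a ^ 2 - 4 * b) := by
    apply mul_left_cancel₀ (show (4 : K) ≠ 0 by norm_num)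
    rw [four_mul_Δ, h6, h4, h2]; ring
  have hD2 : E₂.Δ = 256 * c ^ 6 * b * (a ^ 2 - 4 * b) ^ 2 := by
    apply mul_left_cancel₀ (show (4 : K) ≠ 0 by norm_num)
    rw [four_mul_Δ, h6', h4', h2']; ring
  have hc1 : E₁.c₄ = 16 * (a ^ 2 - 3 * b) := by rw [c₄, h4, h2]; ring
  have hc2 : E₂.c₄ = 16 * c ^ 2 * (a ^ 2 + 12 * b) := by rw [c₄, h4', h2']; ring
  have j1 := E₁.j_mul_Δ
  have j2 := E₂.j_mul_Δ
  have hD : a ^ 2 - 4 * b ≠ 0 := by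
    intro h0
    exact E₁.isUnit_Δ.ne_zero (by rw [hD1, h0, mul_zero])
  rw [hD1, hc1] at j1
  rw [hD2, hc2] at j2
  refine ⟨16 * (a ^ 2 - 4 * b) / b, div_ne_zero (mul_ne_zero (by norm_num) hD) hb, ?_, ?_⟩
  · field_simp
    linear_combination 1 / 16 * j1
  · field_simp
    apply mul_left_cancel₀ (pow_ne_zero 6 hc)
    linear_combination j2

-- `N / Q` plays the role of `φ^* x` in lowest terms. Moving the pole of `N / Q` to `0` brings `E₁`
-- to the form `y² = x(x² + ax + b)`, and over the algebraic closure the right side splits into the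
-- three quadratics `N - rᵢ Q`, with `rᵢ` the 2-torsion abscissas of `E₂`.
open Polynomial in
lemma exists_hauptmodul_of_mul_sq_eq {K : Type*} [Field K] [CharZero K] (E₁ E₂ : WeierstrassCurve K)
    [E₁.IsElliptic] [E₂.IsElliptic] {N Q s g : K[X]} (hg : g ≠ 0) (hNQ : IsCoprime N Q)
    (hQ : Q.Monic) (hN2 : N.natDegree = 2) (hQ1 : Q.natDegree ≤ 1)
    (h : E₁.Ψ₂Sq * s ^ 2 * Q = g ^ 2 * (4 * N ^ 3 + C E₂.b₂ * N ^ 2 * Q +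
      C (2 * E₂.b₄) * N * Q ^ 2 + C E₂.b₆ * Q ^ 3)) :
    ∃ h : K, h ≠ 0 ∧ E₁.j * h = (h + 16) ^ 3 ∧ E₂.j * h ^ 2 = (h + 256) ^ 3 := by
  rcases Nat.le_one_iff_eq_zero_or_eq_one.1 hQ1 with hQ0 | hQ1
  · exfalso
    obtain rfl : Q = 1 := hQ.natDegree_eq_zero.1 hQ0
    have hcomp : 4 * N ^ 3 + C E₂.b₂ * N ^ 2 * 1 + C (2 * E₂.b₄) * N * 1 ^ 2 + C E₂.b₆ * 1 ^ 3 =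
        E₂.Ψ₂Sq.comp N := by
      rw [WeierstrassCurve.Ψ₂Sq, ← C_ofNat]
      simp only [add_comp, mul_comp, C_comp, pow_comp, X_comp]
      ring
    have hd : (E₂.Ψ₂Sq.comp N).natDegree = 6 := by
      rw [natDegree_comp, hN2, E₂.natDegree_Ψ₂Sq (by norm_num)]
    have hne : E₂.Ψ₂Sq.comp N ≠ 0 := by rintro h0; simp [h0] at hd
    rw [hcomp, mul_one] at h
    have hs : s ≠ 0 := by
      rintro rfl
      have : g ^ 2 * E₂.Ψ₂Sq.comp N ≠ 0 := by positivity
      exact this (by rw [← h]; simp)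
    have hΨ := E₁.Ψ₂Sq_ne_zero (by norm_num)
    -- With `Q = 1` the left side has odd degree `3 + 2 deg s` and the right side even degree `6 + 2
    -- deg g`.
    have := congrArg natDegree h
    rw [natDegree_mul hΨ (by positivity), natDegree_mul (by positivity) hne, hd, natDegree_pow,
      natDegree_pow, E₁.natDegree_Ψ₂Sq (by norm_num)] at this
    omega
  obtain ⟨x₀, rfl⟩ : ∃ x₀, Q = X - C x₀ := by
    refine ⟨-Q.coeff 0, ?_⟩
    rw [hQ.eq_X_add_C hQ1]; simp
  have hx₀ : N.eval x₀ ≠ 0 := by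
    obtain ⟨u, v, huv⟩ := hNQ
    intro h0
    have := congrArg (eval x₀) huv
    simp [h0] at this
  obtain ⟨c, d, n, hN⟩ : ∃ c d n : K, N.comp (X + C x₀) = C c * X ^ 2 + C d * X + C n := by
    refine ⟨_, _, _, eq_quadratic_of_degree_le_two (natDegree_le_iff_degree_le.1 ?_)⟩
    rw [natDegree_comp, hN2, natDegree_X_add_C]
  have hc : c ≠ 0 := by
    rintro rfl
    have h1 : (N.comp (X + C x₀)).natDegree = 2 := by rw [natDegree_comp, hN2, natDegree_X_add_C]
    have h2 : (C d * X + C n).natDegree ≤ 1 := natDegree_linear_le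
    rw [hN] at h1
    simp only [map_zero, zero_mul, zero_add] at h1
    omega
  have hn : n ≠ 0 := by
    rintro rfl
    have := congrArg (eval 0) hN
    simp [hx₀] at this
  -- `a`, `b` and `e` are read off the Taylor expansion of `Ψ₂Sq` at `x₀`, namely `4X(X² + aX + b) +
  -- e`.
  obtain ⟨a, ha⟩ : ∃ a, a = (E₁.b₂ + 12 * x₀) / 4 := ⟨_, rfl⟩
  obtain ⟨b, hb⟩ : ∃ b, b = (6 * x₀ ^ 2 + E₁.b₂ * x₀ + E₁.b₄) / 2 := ⟨_, rfl⟩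
  have hb2 : E₁.b₂ = 4 * a - 12 * x₀ := by rw [ha]; ring
  have hb4 : E₁.b₄ = 2 * b - 6 * x₀ ^ 2 - E₁.b₂ * x₀ := by rw [hb]; ring
  obtain ⟨e, he⟩ : ∃ e, e = 4 * x₀ ^ 3 + E₁.b₂ * x₀ ^ 2 + 2 * E₁.b₄ * x₀ + E₁.b₆ := ⟨_, rfl⟩
  have hΨ : E₁.Ψ₂Sq.comp (X + C x₀) = 4 * X * (X ^ 2 + C a * X + C b) + C e := by
    have hb6 : E₁.b₆ = e - (4 * x₀ ^ 3 + E₁.b₂ * x₀ ^ 2 + 2 * E₁.b₄ * x₀) := by rw [he]; ring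
    rw [WeierstrassCurve.Ψ₂Sq, hb6, hb4, hb2]
    simp only [add_comp, mul_comp, C_comp, pow_comp, X_comp]
    simp only [map_add, map_sub, map_mul, map_pow, map_ofNat]
    ring
  obtain ⟨s', hs'⟩ : ∃ s', s' = s.comp (X + C x₀) := ⟨_, rfl⟩
  obtain ⟨g', hg'⟩ : ∃ g', g' = g.comp (X + C x₀) := ⟨_, rfl⟩
  have hg0 : g' ≠ 0 := by
    rw [hg', Ne, comp_eq_zero_iff]
    rintro (h0 | ⟨-, h0⟩)
    · exact hg h0
    · have := congrArg natDegree h0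
      simp at this
  have h1 := congrArg (fun p => p.comp (X + C x₀)) h
  simp only [add_comp, sub_comp, mul_comp, C_comp, pow_comp, X_comp, hΨ, hN, ← hs', ← hg',
    ofNat_comp, Nat.cast_ofNat, add_sub_cancel_right] at h1
  -- After multiplication by `X` the left side is the shifted cubic times a square, while the right
  -- side has odd order at `0` since the last factor takes the value `4n³ ≠ 0`. Hence `x₀` is a
  -- 2-torsion abscissa.
  have he0 : e = 0 := by
    have := Polynomial.eval_eq_zero_of_mul_sq_eq (γ := 0)
      (u := 4 * X * (X ^ 2 + C a * X + C b) + C e) (t := X * s') (g := g')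
      (v := 4 * (C c * X ^ 2 + C d * X + C n) ^ 3 +
        C E₂.b₂ * (C c * X ^ 2 + C d * X + C n) ^ 2 * X +
        C (2 * E₂.b₄) * (C c * X ^ 2 + C d * X + C n) * X ^ 2 + C E₂.b₆ * X ^ 3)
      (by rw [map_zero, sub_zero]; linear_combination X * h1) hg0 (by simpa using hn)
    simpa using this
  have hb6 : E₁.b₆ = -(4 * x₀ ^ 3 + E₁.b₂ * x₀ ^ 2 + 2 * E₁.b₄ * x₀) := by
    linear_combination he0 - he
  rw [he0, map_zero, add_zero] at h1
  obtain ⟨φ, -⟩ : ∃ φ : K →+* AlgebraicClosure K, φ = algebraMap _ _ := ⟨_, rfl⟩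
  have hP : (E₂.twoTorsionPolynomial).a ≠ 0 := show (4 : K) ≠ 0 by norm_num
  obtain ⟨r₁, r₂, r₃, hr⟩ := (Cubic.splits_iff_roots_eq_three (φ := φ) hP).1
    (IsAlgClosed.splits _)
  obtain ⟨h12, h13, h23⟩ := (Cubic.discr_ne_zero_iff_roots_ne hP hr).1 (by
    rw [twoTorsionPolynomial_discr]
    exact mul_ne_zero (by norm_num) E₂.isUnit_Δ.ne_zero)
  have e2 : φ E₂.b₂ = φ 4 * -(r₁ + r₂ + r₃) := Cubic.b_eq_three_roots hP hr
  have e4 : φ (2 * E₂.b₄) = φ 4 * (r₁ * r₂ + r₁ * r₃ + r₂ * r₃) := Cubic.c_eq_three_roots hP hr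
  have e6 : φ E₂.b₆ = φ 4 * -(r₁ * r₂ * r₃) := Cubic.d_eq_three_roots hP hr
  rw [map_ofNat] at e2 e4 e6
  have h2 := congrArg (Polynomial.map φ) h1
  simp only [Polynomial.map_mul, Polynomial.map_add, Polynomial.map_pow, Polynomial.map_X,
    Polynomial.map_C, Polynomial.map_ofNat, e2, e4, e6] at h2
  obtain ⟨k1, k2, k3, k4⟩ := symmetric_functions_of_mul_sq_eq (c := φ c) (d := φ d) (g := φ n)
    (a := φ a) (b := φ b) (t := X * s'.map φ) (G := g'.map φ) (by simpa using hc)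
    (by simpa using hn) (by simpa [Polynomial.map_eq_zero] using hg0) h12 h13 h23 (by
      apply mul_left_cancel₀ (show (4 : (AlgebraicClosure K)[X]) ≠ 0 by norm_num)
      simp only [map_sub, map_mul, map_neg, map_add, map_ofNat] at h2 ⊢
      linear_combination h2)
  have hφ : Function.Injective φ := φ.injective
  have hnb : n = c * b := hφ (by rw [k1, map_mul])
  refine j_eq_of_two_torsion_form E₁ E₂ (x₀ := x₀) (a := a) (b := b) (c := c) (d := d) ?_ hc hb2 hb4
    hb6 ?_ ?_ ?_
  · rintro rfl
    exact hn (by rw [hnb, mul_zero])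
  · apply hφ
    rw [e2, k2]; simp only [map_mul, map_sub, map_neg, map_ofNat]; ring
  · apply mul_left_cancel₀ (two_ne_zero' K)
    apply hφ
    rw [e4, k3]; simp only [map_mul, map_sub, map_add, map_pow, map_ofNat]; ring
  · apply hφ
    rw [e6, k4]; simp only [map_mul, map_sub, map_neg, map_pow, map_ofNat]; ring

/-! ### Pole orders and evaluation in the coordinate ring -/

namespace WeierstrassCurve.Affine.CoordinateRing

open Polynomial

section Norm

variable {K : Type*} [Field K] {E : WeierstrassCurve K}

/-- Completing the square: negation on the curve fixes `x` and changes the sign of `ψ₂`, so this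
splits a function into its even and odd parts. -/
lemma exists_add_mul_ψ₂ [CharZero K] (g : E.toAffine.CoordinateRing) :
    ∃ p q : K[X], g = algebraMap _ _ p + algebraMap _ _ q * mk E.toAffine E.ψ₂ := by
  obtain ⟨p, q, rfl⟩ := exists_smul_basis_eq g
  refine ⟨p - C 2⁻¹ * q * (C E.a₁ * X + C E.a₃), C 2⁻¹ * q, ?_⟩
  have h2 : (C 2⁻¹ * 2 : K[X]) = 1 := by
    rw [← C_ofNat, ← C_mul, inv_mul_cancel₀ two_ne_zero, C_1]
  have h : mk E.toAffine E.ψ₂ = algebraMap K[X] _ 2 * mk E.toAffine X +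
      algebraMap K[X] _ (C E.a₁ * X + C E.a₃) := by
    rw [WeierstrassCurve.ψ₂, polynomialY, map_add, map_mul]; rfl
  have h2' := congrArg (algebraMap K[X] E.toAffine.CoordinateRing) h2
  rw [h, Algebra.smul_def, Algebra.smul_def]
  simp only [map_sub, map_mul, map_one] at h2' ⊢
  linear_combination -algebraMap K[X] E.toAffine.CoordinateRing q * mk E.toAffine X * h2'

lemma mk_ψ₂_sq_eq : mk E.toAffine E.ψ₂ ^ 2 = algebraMap _ _ E.Ψ₂Sq :=
  mk_ψ₂_sq E

instance : Module.Finite K[X] E.toAffine.CoordinateRing :=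
  Module.Finite.of_basis (CoordinateRing.basis E.toAffine)

/-- The order of the pole at infinity. -/
noncomputable def poleOrder (g : E.toAffine.CoordinateRing) : WithBot ℕ :=
  (Algebra.norm K[X] g).degree

lemma poleOrder_mul (f g : E.toAffine.CoordinateRing) :
    poleOrder (f * g) = poleOrder f + poleOrder g := by
  rw [poleOrder, map_mul, degree_mul]; rfl

lemma poleOrder_pow (f : E.toAffine.CoordinateRing) (n : ℕ) :
    poleOrder (f ^ n) = n • poleOrder f := by
  rw [poleOrder, map_pow, degree_pow]; rfl

lemma poleOrder_zero : poleOrder (0 : E.toAffine.CoordinateRing) = ⊥ := by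
  rw [poleOrder, Algebra.norm_zero, degree_zero]

lemma poleOrder_smul_basis (p q : K[X]) :
    poleOrder (p • (1 : E.toAffine.CoordinateRing) + q • mk E.toAffine X) =
      max (2 • p.degree) (2 • q.degree + 3) :=
  degree_norm_smul_basis p q

lemma poleOrder_add_le (f g : E.toAffine.CoordinateRing) :
    poleOrder (f + g) ≤ max (poleOrder f) (poleOrder g) := by
  obtain ⟨p, q, rfl⟩ := exists_smul_basis_eq f
  obtain ⟨r, s, rfl⟩ := exists_smul_basis_eq g
  rw [show p • (1 : E.toAffine.CoordinateRing) + q • mk E.toAffine X +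
    (r • (1 : E.toAffine.CoordinateRing) + s • mk E.toAffine X) =
    (p + r) • (1 : E.toAffine.CoordinateRing) + (q + s) • mk E.toAffine X by
      simp only [add_smul]; ring]
  simp only [poleOrder_smul_basis]
  refine max_le ?_ ?_
  · refine (nsmul_le_nsmul_right (degree_add_le p r) 2).trans ?_
    rcases le_total p.degree r.degree with h | h
    · rw [max_eq_right h]; exact (le_max_left _ _).trans (le_max_right _ _)
    · rw [max_eq_left h]; exact (le_max_left _ _).trans (le_max_left _ _)
  · refine (add_le_add_left (nsmul_le_nsmul_right (degree_add_le q s) 2) 3).trans ?_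
    rcases le_total q.degree s.degree with h | h
    · rw [max_eq_right h]; exact (le_max_right _ _).trans (le_max_right _ _)
    · rw [max_eq_left h]; exact (le_max_right _ _).trans (le_max_left _ _)

lemma poleOrder_algebraMap (p : K[X]) :
    poleOrder (algebraMap K[X] E.toAffine.CoordinateRing p) = 2 • p.degree := by
  have := poleOrder_smul_basis (E := E) p 0
  rw [zero_smul, add_zero, ← Algebra.algebraMap_eq_smul_one] at this
  rw [this]
  simp

lemma poleOrder_neg (f : E.toAffine.CoordinateRing) : poleOrder (-f) = poleOrder f := by
  have h : -f = algebraMap K[X] _ (-1) * f := by simp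
  rw [h, poleOrder_mul, poleOrder_algebraMap, degree_neg, degree_one, nsmul_zero, zero_add]

lemma poleOrder_mk_Y : poleOrder (mk E.toAffine X) = 3 := by
  have := poleOrder_smul_basis (E := E) 0 1
  rw [zero_smul, zero_add, one_smul] at this
  rw [this]
  simp

/-- A form of degree `n` evaluated at `[x : y : 1]`. -/
noncomputable def dehomogenize (E : WeierstrassCurve K) :
    MvPolynomial (Fin 3) K →ₐ[K] E.toAffine.CoordinateRing :=
  MvPolynomial.aeval ![mk E.toAffine (C X), mk E.toAffine X, 1]

lemma poleOrder_monomial (m : Fin 3 →₀ ℕ) {a : K} (ha : a ≠ 0) :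
    poleOrder (dehomogenize E (MvPolynomial.monomial m a)) = ((2 * m 0 + 3 * m 1 : ℕ) : WithBot ℕ) := by
  have hX : mk E.toAffine (C X) = algebraMap K[X] _ X := rfl
  have ha' : algebraMap K E.toAffine.CoordinateRing a = algebraMap K[X] _ (C a) := rfl
  rw [dehomogenize, MvPolynomial.aeval_monomial, Finsupp.prod_fintype _ _ (by simp),
    Fin.prod_univ_three, ha']
  simp only [Matrix.cons_val_zero, Matrix.cons_val_one, Matrix.cons_val, one_pow, mul_one,
    poleOrder_mul, poleOrder_pow, hX, poleOrder_algebraMap, poleOrder_mk_Y, degree_C ha, degree_X]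
  simp [mul_comm]

/-- Since `x` and `y` have poles of order 2 and 3, the only monomial of degree `n` whose pole order
reaches `3n` is `Yⁿ`; its coefficient is the value of the form at `[0 : 1 : 0]`. -/
lemma poleOrder_dehomogenize_lt {F : MvPolynomial (Fin 3) K} {n : ℕ} (hF : F.IsHomogeneous n)
    (h : F.coeff (Finsupp.single 1 n) = 0) :
    poleOrder (dehomogenize E F) < ((3 * n : ℕ) : WithBot ℕ) := by
  rw [F.as_sum, map_sum]
  refine Finset.sum_induction _ (fun g => poleOrder g < ((3 * n : ℕ) : WithBot ℕ))
    (fun f g hf hg => (poleOrder_add_le f g).trans_lt (max_lt hf hg))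
    (by rw [poleOrder_zero]; exact WithBot.bot_lt_coe _) ?_
  intro m hm
  have hm := MvPolynomial.mem_support_iff.1 hm
  rw [poleOrder_monomial _ hm, Nat.cast_lt]
  have hdeg : m.degree = n := by
    rw [Finsupp.degree_eq_weight_one]
    exact hF hm
  rw [Finsupp.degree_eq_sum, Fin.sum_univ_three] at hdeg
  by_contra hlt
  have h1 : m 1 = n := by omega
  apply hm
  rw [← h]
  congr 1
  ext i
  fin_cases i <;> simp <;> omega

lemma le_poleOrder_dehomogenize {F : MvPolynomial (Fin 3) K} {n : ℕ} (hF : F.IsHomogeneous n)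
    (h : F.coeff (Finsupp.single 1 n) ≠ 0) :
    ((3 * n : ℕ) : WithBot ℕ) ≤ poleOrder (dehomogenize E F) := by
  obtain ⟨M, hM⟩ : ∃ M, M = MvPolynomial.monomial (Finsupp.single (1 : Fin 3) n)
    (F.coeff (Finsupp.single 1 n)) := ⟨_, rfl⟩
  have hMo : poleOrder (dehomogenize E M) = ((3 * n : ℕ) : WithBot ℕ) := by
    rw [hM, poleOrder_monomial _ h]; simp
  have hG : poleOrder (dehomogenize E (F - M)) < ((3 * n : ℕ) : WithBot ℕ) := by
    apply poleOrder_dehomogenize_lt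
    · apply hF.sub
      rw [hM]
      apply MvPolynomial.isHomogeneous_monomial
      simp
    · rw [hM]; simp
  by_contra hlt
  rw [not_le] at hlt
  have : dehomogenize E M = dehomogenize E F + -dehomogenize E (F - M) := by
    rw [map_sub]; ring
  have h2 := poleOrder_add_le (dehomogenize E F) (-dehomogenize E (F - M))
  rw [← this, poleOrder_neg, hMo] at h2
  exact absurd h2 (not_le.2 (max_lt hlt hG))

end Norm

section Eval

variable {K : Type*} [Field K] {E : WeierstrassCurve K} {F : Type*} [Field F] [Algebra K F]

/-- Evaluation at a point. -/
noncomputable def evalPoint {x y : F} (h : (E.baseChange F).toAffine.Equation x y) :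
    E.toAffine.CoordinateRing →ₐ[K] F :=
  AdjoinRoot.liftAlgHom _ (aeval x : K[X] →ₐ[K] F) y (by
    have h : y ^ 2 + algebraMap K F E.a₁ * x * y + algebraMap K F E.a₃ * y =
      x ^ 3 + algebraMap K F E.a₂ * x ^ 2 + algebraMap K F E.a₄ * x + algebraMap K F E.a₆ :=
      (equation_iff x y).1 h
    simp only [polynomial, eval₂_add, eval₂_sub, eval₂_mul, eval₂_pow, eval₂_X, eval₂_C]
    simp
    linear_combination h)

lemma evalPoint_algebraMap {x y : F} (h : (E.baseChange F).toAffine.Equation x y) (p : K[X]) :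
    evalPoint h (algebraMap _ _ p) = aeval x p := by
  have : algebraMap K[X] E.toAffine.CoordinateRing p = AdjoinRoot.mk _ (C p) := rfl
  rw [this, evalPoint, AdjoinRoot.liftAlgHom_mk, eval₂_C]
  rfl

lemma evalPoint_mk_Y {x y : F} (h : (E.baseChange F).toAffine.Equation x y) :
    evalPoint h (mk _ X) = y := by
  rw [evalPoint, AdjoinRoot.liftAlgHom_mk, eval₂_X]

lemma evalPoint_mk_ψ₂ {x y : F} (h : (E.baseChange F).toAffine.Equation x y) :
    evalPoint h (mk _ E.ψ₂) = 2 * y + algebraMap K F E.a₁ * x + algebraMap K F E.a₃ := by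
  rw [WeierstrassCurve.ψ₂, polynomialY, evalPoint, AdjoinRoot.liftAlgHom_mk]
  simp only [eval₂_add, eval₂_mul, eval₂_X, eval₂_C]
  simp only [RingHom.coe_coe, map_add, map_mul, aeval_C, aeval_X, map_ofNat]
  ring

lemma evalPoint_dehomogenize {x y : F} (h : (E.baseChange F).toAffine.Equation x y)
    (p : MvPolynomial (Fin 3) K) :
    evalPoint h (dehomogenize E p) = MvPolynomial.aeval ![x, y, 1] p := by
  rw [dehomogenize, ← AlgHom.comp_apply, MvPolynomial.comp_aeval]
  congr 2
  ext i
  fin_cases i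
  · exact (evalPoint_algebraMap h X).trans (aeval_X x)
  · exact evalPoint_mk_Y h
  · exact map_one (evalPoint h)

lemma exists_equation [CharZero K] [IsAlgClosed F] (E : WeierstrassCurve K) (x : F) :
    ∃ y, (E.baseChange F).toAffine.Equation x y := by
  have : CharZero F := charZero_of_injective_algebraMap (algebraMap K F).injective
  obtain ⟨t, ht⟩ := IsAlgClosed.exists_pow_nat_eq (aeval x E.Ψ₂Sq) two_pos
  -- Solves `2y + a₁x + a₃ = t`, where `t² = Ψ₂Sq(x)`.
  refine ⟨(t - algebraMap K F E.a₁ * x - algebraMap K F E.a₃) / 2, ?_⟩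
  rw [equation_iff]
  change _ ^ 2 + algebraMap K F E.a₁ * x * _ + algebraMap K F E.a₃ * _ =
    x ^ 3 + algebraMap K F E.a₂ * x ^ 2 + algebraMap K F E.a₄ * x + algebraMap K F E.a₆
  simp only [Ψ₂Sq, b₂, b₄, b₆, map_add, map_mul, aeval_X, aeval_C, map_pow, map_ofNat] at ht
  linear_combination ht / 4

end Eval

end WeierstrassCurve.Affine.CoordinateRing

open MvPolynomial in
lemma MvPolynomial.IsHomogeneous.aeval_zero_one_zero {K L : Type*} [Field K] [Field L] [Algebra K L]
    {F : MvPolynomial (Fin 3) K} {n : ℕ} (hF : F.IsHomogeneous n) :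
    MvPolynomial.aeval ![(0 : L), 1, 0] F = algebraMap K L (F.coeff (Finsupp.single 1 n)) := by
  rw [aeval_def, eval₂_eq', Finset.sum_eq_single (Finsupp.single 1 n)]
  · simp [Fin.prod_univ_three]
  · intro m hm hne
    have hm := mem_support_iff.1 hm
    have hdeg : m.degree = n := by
      rw [Finsupp.degree_eq_weight_one]
      exact hF hm
    rw [Finsupp.degree_eq_sum, Fin.sum_univ_three] at hdeg
    have h02 : m 0 ≠ 0 ∨ m 2 ≠ 0 := by
      by_contra! h
      apply hne
      ext i
      fin_cases i <;> simp <;> omega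
    rw [Fin.prod_univ_three]
    rcases h02 with h | h <;> simp [h]
  · intro h
    rw [notMem_support_iff.1 h, map_zero, zero_mul]

/-! ### The isogeny as a rational function of `x` -/

namespace EllipticIsogeny

open Polynomial WeierstrassCurve.Affine.CoordinateRing

variable {K : Type*} [Field K]

instance (E : WeierstrassCurve K) [E.IsElliptic] :
    (E.baseChange (AlgebraicClosure K)).IsElliptic :=
  inferInstanceAs (E.map (algebraMap K (AlgebraicClosure K))).IsElliptic

lemma coords_some {E : WeierstrassCurve K} {x y : AlgebraicClosure K}
    (h : (E.baseChange (AlgebraicClosure K)).toAffine.Nonsingular x y) :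
    coords (E := E) (.some x y h) = ![x, y, 1] := rfl

lemma coords_zero {E : WeierstrassCurve K} : coords (0 : GeomPoint E) = ![0, 1, 0] := rfl

/-- Evenness of `x` and oddness of `2y + a₁x + a₃`, cross-multiplied so that they also hold at
infinity. -/
lemma coords_neg (E : WeierstrassCurve K) (R : GeomPoint E) :
    coords R 0 * coords (-R) 2 = coords (-R) 0 * coords R 2 ∧
    (2 * coords R 1 + algebraMap K _ E.a₁ * coords R 0 + algebraMap K _ E.a₃ * coords R 2) *
      coords (-R) 2 =
    -(2 * coords (-R) 1 + algebraMap K _ E.a₁ * coords (-R) 0 +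
      algebraMap K _ E.a₃ * coords (-R) 2) * coords R 2 := by
  rcases R with _ | ⟨x, y, h⟩
  · change coords (0 : GeomPoint E) 0 * coords (0 : GeomPoint E) 2 =
      coords (0 : GeomPoint E) 0 * coords (0 : GeomPoint E) 2 ∧
      _ * coords (0 : GeomPoint E) 2 = _ * coords (0 : GeomPoint E) 2
    rw [coords_zero]
    simp
  · rw [Affine.Point.neg_some, coords_some, coords_some]
    have : (E.baseChange (AlgebraicClosure K)).toAffine.negY x y =
      -y - algebraMap K _ E.a₁ * x - algebraMap K _ E.a₃ := rfl
    simp only [this, Matrix.cons_val_zero, Matrix.cons_val_one, Matrix.cons_val]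
    exact ⟨trivial, by ring⟩

lemma eq_zero_of_aeval_mul_eq_zero {Ψ g : K[X]} (hΨ : Ψ ≠ 0)
    (h : ∀ x : AlgebraicClosure K, aeval x Ψ * aeval x g = 0) : g = 0 := by
  have hinj := (algebraMap K (AlgebraicClosure K)).injective
  have h0 : (Ψ * g).map (algebraMap K (AlgebraicClosure K)) = 0 := by
    apply Polynomial.funext
    intro x
    rw [eval_map_algebraMap, map_mul, h, eval_zero]
  rw [Polynomial.map_eq_zero_iff hinj] at h0
  exact (mul_eq_zero.1 h0).resolve_left hΨ

/-- Forms representing an isogeny, as regular functions on the affine part of the source. -/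
lemma exists_forms [CharZero K] {E₁ E₂ : WeierstrassCurve K} [E₁.IsElliptic] [E₂.IsElliptic]
    (φ : Isogeny E₁ E₂) :
    ∃ A : Fin 3 → E₁.toAffine.CoordinateRing, poleOrder (A 2) < poleOrder (A 1) ∧
      (algebraMap _ E₁.toAffine.FunctionField (A 0) =
        algebraMap _ E₁.toAffine.FunctionField (A 2) * φ.pullback (xFun E₂)) ∧
      (algebraMap _ E₁.toAffine.FunctionField (A 1) =
        algebraMap _ E₁.toAffine.FunctionField (A 2) * φ.pullback (yFun E₂)) ∧
      ∀ (x y y' : AlgebraicClosure K)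
        (h : (E₁.baseChange (AlgebraicClosure K)).toAffine.Equation x y)
        (h' : (E₁.baseChange (AlgebraicClosure K)).toAffine.Equation x y'),
        y' = (E₁.baseChange (AlgebraicClosure K)).toAffine.negY x y →
        evalPoint h (A 0) * evalPoint h' (A 2) = evalPoint h' (A 0) * evalPoint h (A 2) ∧
        (2 * evalPoint h (A 1) + algebraMap K _ E₂.a₁ * evalPoint h (A 0) +
          algebraMap K _ E₂.a₃ * evalPoint h (A 2)) * evalPoint h' (A 2) =
        -(2 * evalPoint h' (A 1) + algebraMap K _ E₂.a₁ * evalPoint h' (A 0) +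
          algebraMap K _ E₂.a₃ * evalPoint h' (A 2)) * evalPoint h (A 2) := by
  classical
  -- The forms valid near the origin are chosen: as the origin maps to the origin, `F 2` vanishes at
  -- `[0 : 1 : 0]` and `F 1` does not, whence the strict inequality of pole orders.
  obtain ⟨n, F, hF, ⟨i, hi⟩, hpts, c, hc⟩ := φ.regular 0
  obtain ⟨c₀, hc₀⟩ := hpts 0
  rw [map_zero, coords_zero, coords_zero] at hc₀
  rw [coords_zero] at hi
  have hcoeff := fun i => (hF i).aeval_zero_one_zero (L := AlgebraicClosure K)
  have hinj := (algebraMap K (AlgebraicClosure K)).injective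
  have hF2 : (F 2).coeff (Finsupp.single 1 n) = 0 := by
    apply hinj
    rw [← hcoeff, map_zero]; simpa using hc₀ 2
  have hF1 : (F 1).coeff (Finsupp.single 1 n) ≠ 0 := by
    intro h
    apply hi
    have h1 := hcoeff 1
    rw [h, map_zero] at h1
    fin_cases i
    · simpa using hc₀ 0
    · exact h1
    · simpa using hc₀ 2
  have hA : ∀ i, algebraMap _ E₁.toAffine.FunctionField (dehomogenize E₁ (F i)) =
      MvPolynomial.aeval ![xFun E₁, yFun E₁, 1] (F i) := by
    intro i
    rw [dehomogenize, ← IsScalarTower.coe_toAlgHom' K, ← AlgHom.comp_apply, MvPolynomial.comp_aeval]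
    congr 2
    ext j
    fin_cases j
    · rfl
    · rfl
    · exact map_one _
  have hcA : algebraMap _ E₁.toAffine.FunctionField (dehomogenize E₁ (F 2)) = c := by
    rw [hA, hc]; simp
  refine ⟨fun i => dehomogenize E₁ (F i), (poleOrder_dehomogenize_lt (hF 2) hF2).trans_le
    (le_poleOrder_dehomogenize (hF 1) hF1), ?_, ?_, ?_⟩
  · rw [hcA, hA, hc]; simp
  · rw [hcA, hA, hc]; simp
  intro x y y' h h' hy'
  obtain ⟨c₁, hc₁⟩ := hpts (.some x y (Affine.equation_iff_nonsingular.1 h))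
  obtain ⟨c₂, hc₂⟩ := hpts (-.some x y (Affine.equation_iff_nonsingular.1 h))
  obtain ⟨r1, r2⟩ := coords_neg E₂ (φ.toHom (.some x y (Affine.equation_iff_nonsingular.1 h)))
  have hneg : φ.toHom (-.some x y (Affine.equation_iff_nonsingular.1 h)) =
    -φ.toHom (.some x y (Affine.equation_iff_nonsingular.1 h)) := map_neg φ.toHom _
  rw [hneg, Affine.Point.neg_some] at hc₂
  simp only [coords_some, ← hy'] at hc₁ hc₂
  simp only [evalPoint_dehomogenize, hc₁, hc₂]
  exact ⟨by linear_combination c₁ * c₂ * r1, by linear_combination c₁ * c₂ * r2⟩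

lemma _root_.WithBot.le_of_two_nsmul_le {a b : WithBot ℕ} (h : 2 • a ≤ 2 • b) : a ≤ b := by
  by_contra! hlt
  rw [two_nsmul, two_nsmul] at h
  induction a with
  | bot => exact absurd hlt (by simp)
  | coe a =>
    induction b with
    | bot => simp at h
    | coe b => norm_cast at *; omega

/-- Compatibility with negation on points forces `A 0 / A 2` to be even and `(2 A 1 + a₁ A 0 + a₃ A
2) / A 2` to be odd. Rationalizing the denominator `A 2` writes them as `P / d` and `(s / d) ψ₂`;
the relation is the equation of `E₂` multiplied by `d³`. -/
lemma exists_rational_form [CharZero K] {E₁ E₂ : WeierstrassCurve K} [E₁.IsElliptic]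
    [E₂.IsElliptic] (φ : Isogeny E₁ E₂) :
    ∃ P s d : K[X], P.degree > d.degree ∧ d ≠ 0 ∧
      algebraMap K[X] E₁.toAffine.FunctionField d * φ.pullback (xFun E₂) =
        algebraMap K[X] E₁.toAffine.FunctionField P ∧
      E₁.Ψ₂Sq * s ^ 2 * d = 4 * P ^ 3 + C E₂.b₂ * P ^ 2 * d +
        C (2 * E₂.b₄) * P * d ^ 2 + C E₂.b₆ * d ^ 3 := by
  obtain ⟨A, hlt, hX, hY, hpts⟩ := exists_forms φ
  obtain ⟨p₀, q₀, h₀⟩ := exists_add_mul_ψ₂ (A 0)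
  obtain ⟨p₁, q₁, h₁⟩ := exists_add_mul_ψ₂ (A 1)
  obtain ⟨p₂, q₂, h₂⟩ := exists_add_mul_ψ₂ (A 2)
  obtain ⟨p, hp⟩ : ∃ p, p = 2 * p₁ + C E₂.a₁ * p₀ + C E₂.a₃ * p₂ := ⟨_, rfl⟩
  obtain ⟨q, hq⟩ : ∃ q, q = 2 * q₁ + C E₂.a₁ * q₀ + C E₂.a₃ * q₂ := ⟨_, rfl⟩
  have hΨ0 := E₁.Ψ₂Sq_ne_zero (show (4 : K) ≠ 0 by norm_num)
  have key : q₀ * p₂ - p₀ * q₂ = 0 ∧ p * p₂ - q * q₂ * E₁.Ψ₂Sq = 0 := by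
    have key (x : AlgebraicClosure K) : aeval x E₁.Ψ₂Sq * aeval x (q₀ * p₂ - p₀ * q₂) = 0 ∧
        aeval x E₁.Ψ₂Sq * aeval x (p * p₂ - q * q₂ * E₁.Ψ₂Sq) = 0 := by
      obtain ⟨y, h⟩ := exists_equation E₁ x
      obtain ⟨y', hy'⟩ : ∃ y', y' = (E₁.baseChange (AlgebraicClosure K)).toAffine.negY x y :=
        ⟨_, rfl⟩
      have h' : (E₁.baseChange (AlgebraicClosure K)).toAffine.Equation x y' := by
        rw [hy']; exact (Affine.equation_neg x y).2 h
      obtain ⟨r1, r2⟩ := hpts x y y' h h' hy'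
      obtain ⟨w, hw⟩ : ∃ w, w = evalPoint h (mk _ E₁.ψ₂) := ⟨_, rfl⟩
      have hw' : evalPoint h' (mk _ E₁.ψ₂) = -w := by
        have hy'' : y' = -y - algebraMap K _ E₁.a₁ * x - algebraMap K _ E₁.a₃ := hy'
        rw [hw, evalPoint_mk_ψ₂, evalPoint_mk_ψ₂, hy'']; ring
      have hw2 : w ^ 2 = aeval x E₁.Ψ₂Sq := by
        rw [hw, ← map_pow, mk_ψ₂_sq_eq, evalPoint_algebraMap]
      rw [h₀, h₂] at r1
      rw [h₀, h₁, h₂] at r2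
      simp only [map_add, map_mul, evalPoint_algebraMap, ← hw, hw'] at r1 r2
      simp only [hp, hq, map_sub, map_add, map_mul, ← hw2, aeval_C, map_ofNat]
      constructor
      · linear_combination w / 2 * r1
      · linear_combination w ^ 2 / 2 * r2
    exact ⟨eq_zero_of_aeval_mul_eq_zero hΨ0 fun x => (key x).1,
      eq_zero_of_aeval_mul_eq_zero hΨ0 fun x => (key x).2⟩
  obtain ⟨I1, I2⟩ := key
  have hA2 : A 2 ≠ 0 := by
    intro h0
    rw [h0, map_zero, zero_mul] at hY
    have hA1 : A 1 = 0 := by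
      apply IsFractionRing.injective E₁.toAffine.CoordinateRing E₁.toAffine.FunctionField
      rw [hY, map_zero]
    rw [h0, hA1] at hlt
    exact lt_irrefl _ hlt
  -- `d` is the norm of `A 2`. With the conjugate `p₂ - q₂ ψ₂` of `A 2`, `P` is the even part of its
  -- product with `A 0`, and `s` the `ψ₂`-coefficient of its product with `p + q ψ₂`.
  obtain ⟨d, hd⟩ : ∃ d, d = p₂ ^ 2 - q₂ ^ 2 * E₁.Ψ₂Sq := ⟨_, rfl⟩
  obtain ⟨P, hP⟩ : ∃ P, P = p₀ * p₂ - q₀ * q₂ * E₁.Ψ₂Sq := ⟨_, rfl⟩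
  obtain ⟨s, hs⟩ : ∃ s, s = q * p₂ - p * q₂ := ⟨_, rfl⟩
  have hd0 : d ≠ 0 := by
    intro h0
    rw [hd, sub_eq_zero] at h0
    by_cases hq₂ : q₂ = 0
    · have hp₂ : p₂ = 0 := by simpa [hq₂] using h0
      exact hA2 (by rw [h₂, hq₂, hp₂]; simp)
    -- Parity again: `Ψ₂Sq` has degree 3, so it is not a square in `K(x)`.
    · have := congrArg natDegree h0
      rw [natDegree_mul (by positivity) hΨ0, natDegree_pow, natDegree_pow,
        E₁.natDegree_Ψ₂Sq (by norm_num)] at this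
      omega
  obtain ⟨ι, hι⟩ : ∃ ι, ι = algebraMap K[X] E₁.toAffine.CoordinateRing := ⟨_, rfl⟩
  obtain ⟨w, hw⟩ : ∃ w, w = mk E₁.toAffine E₁.ψ₂ := ⟨_, rfl⟩
  have hw2 : w ^ 2 = ι E₁.Ψ₂Sq := by rw [hw, hι, mk_ψ₂_sq_eq]
  rw [← hι, ← hw] at h₀ h₁ h₂
  have J1 := congrArg ι I1
  have J2 := congrArg ι I2
  have hpι := congrArg ι hp
  have hqι := congrArg ι hq
  have hdι := congrArg ι hd
  have hPι := congrArg ι hP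
  have hsι := congrArg ι hs
  simp only [map_sub, map_add, map_mul, map_pow, map_zero, map_ofNat, ← hw2] at J1 J2 hpι hqι hdι hPι hsι
  have e1 : ι d * A 0 = A 2 * ι P := by
    rw [h₀, h₂, hdι, hPι]
    linear_combination (ι p₂ * w + ι q₂ * w ^ 2) * J1
  have e2 : ι d * (2 * A 1 + ι (C E₂.a₁) * A 0 + ι (C E₂.a₃) * A 2) = A 2 * (ι s * w) := by
    have : 2 * A 1 + ι (C E₂.a₁) * A 0 + ι (C E₂.a₃) * A 2 = ι p + ι q * w := by
      rw [h₀, h₁, h₂, hpι, hqι]; ring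
    rw [this, h₂, hdι, hsι]
    linear_combination (ι p₂ + ι q₂ * w) * J2
  obtain ⟨θ, hθ⟩ : ∃ θ, θ = algebraMap E₁.toAffine.CoordinateRing E₁.toAffine.FunctionField :=
    ⟨_, rfl⟩
  have hθinj : Function.Injective θ := by rw [hθ]; exact IsFractionRing.injective _ _
  rw [← hθ] at hX hY
  have hθA : θ (A 2) ≠ 0 := by rwa [Ne, map_eq_zero_iff θ hθinj]
  have f1 := congrArg θ e1
  have f2 := congrArg θ e2
  simp only [map_mul, map_add, hX, hY, map_ofNat] at f1 f2
  have g1 : θ (ι d) * φ.pullback (xFun E₂) = θ (ι P) := by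
    apply mul_left_cancel₀ hθA; linear_combination f1
  have g2 : θ (ι d) * (2 * φ.pullback (yFun E₂) + θ (ι (C E₂.a₁)) * φ.pullback (xFun E₂) +
      θ (ι (C E₂.a₃))) = θ (ι s) * θ w := by
    apply mul_left_cancel₀ hθA; linear_combination f2
  have hC : ∀ a : K, θ (ι (C a)) = algebraMap K _ a := by
    intro a
    rw [hθ, hι]
    rfl
  have hrel : (2 * φ.pullback (yFun E₂) + θ (ι (C E₂.a₁)) * φ.pullback (xFun E₂) +
      θ (ι (C E₂.a₃))) ^ 2 = 4 * φ.pullback (xFun E₂) ^ 3 +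
      θ (ι (C E₂.b₂)) * φ.pullback (xFun E₂) ^ 2 +
      θ (ι (C (2 * E₂.b₄))) * φ.pullback (xFun E₂) + θ (ι (C E₂.b₆)) := by
    have h1 := congrArg (fun g => φ.pullback (algebraMap _ E₂.toAffine.FunctionField g))
      (mk_ψ₂_sq E₂)
    have hXX : algebraMap _ E₂.toAffine.FunctionField (mk E₂.toAffine (C X)) = xFun E₂ := rfl
    have hYY : algebraMap _ E₂.toAffine.FunctionField (mk E₂.toAffine X) = yFun E₂ := rfl
    have hCC : ∀ a : K, φ.pullback (algebraMap _ E₂.toAffine.FunctionField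
      (mk E₂.toAffine (C (C a)))) = algebraMap K _ a := fun a => φ.pullback.commutes a
    simp only [WeierstrassCurve.ψ₂, Affine.polynomialY, WeierstrassCurve.Ψ₂Sq, map_add, map_mul,
      map_pow, hXX, hYY, hCC] at h1
    simp only [hC]
    simp only [map_mul, map_ofNat] at h1 ⊢
    linear_combination h1
  have hw2' := congrArg θ hw2
  rw [map_pow] at hw2'
  have heq : E₁.Ψ₂Sq * s ^ 2 * d = 4 * P ^ 3 + C E₂.b₂ * P ^ 2 * d +
        C (2 * E₂.b₄) * P * d ^ 2 + C E₂.b₆ * d ^ 3 := by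
    have hιinj : Function.Injective ι := by
      rw [hι]; exact FaithfulSMul.algebraMap_injective _ _
    apply hιinj
    apply hθinj
    simp only [map_mul, map_add, map_pow, map_ofNat, ← g1, ← hw2'] at hrel ⊢
    linear_combination θ (ι d) ^ 3 * hrel - θ (ι d) * (θ (ι s) * θ w + θ (ι d) *
      (2 * φ.pullback (yFun E₂) + θ (ι (C E₂.a₁)) * φ.pullback (xFun E₂) + θ (ι (C E₂.a₃)))) * g2
  refine ⟨P, s, d, ?_, hd0, ?_, heq⟩
  -- If `deg P ≤ deg d`, the cubic relation bounds `deg (Ψ₂Sq s²)` by `2 deg d`. Then `φ^* x` and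
  -- `φ^* y` have no pole at infinity, against `poleOrder (A 2) < poleOrder (A 1)`.
  · by_contra! hle
    have hdd : d.degree = (d.natDegree : WithBot ℕ) := degree_eq_natDegree hd0
    have hcub : (E₁.Ψ₂Sq * s ^ 2).degree ≤ 2 • d.degree := by
      by_cases h0 : E₁.Ψ₂Sq * s ^ 2 = 0
      · rw [h0, degree_zero]; exact bot_le
      have hPN : P.natDegree ≤ d.natDegree := natDegree_le_natDegree hle
      have hR : (4 * P ^ 3 + C E₂.b₂ * P ^ 2 * d + C (2 * E₂.b₄) * P * d ^ 2 +
          C E₂.b₆ * d ^ 3).natDegree ≤ 3 * d.natDegree := by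
        refine natDegree_add_le_of_degree_le (natDegree_add_le_of_degree_le
          (natDegree_add_le_of_degree_le ?_ ?_) ?_) ?_
        · exact (natDegree_mul_le_of_le (natDegree_ofNat 4).le
            (natDegree_pow_le_of_le 3 hPN)).trans (by omega)
        · exact (natDegree_mul_le_of_le (natDegree_mul_le_of_le (natDegree_C _).le
            (natDegree_pow_le_of_le 2 hPN)) le_rfl).trans (by omega)
        · exact (natDegree_mul_le_of_le (natDegree_mul_le_of_le (natDegree_C _).le hPN)
            (natDegree_pow_le_of_le 2 le_rfl)).trans (by omega)
        · exact (natDegree_mul_le_of_le (natDegree_C _).le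
            (natDegree_pow_le_of_le 3 le_rfl)).trans (by omega)
      rw [← heq, natDegree_mul h0 hd0] at hR
      rw [degree_eq_natDegree h0, hdd, nsmul_eq_mul, ← Nat.cast_mul, Nat.cast_le]
      omega
    have hsw : poleOrder (ι s * w) ≤ 2 • d.degree := by
      apply WithBot.le_of_two_nsmul_le
      rw [← poleOrder_pow, mul_pow, hw2, ← map_pow, ← map_mul, hι, poleOrder_algebraMap, mul_comm]
      exact nsmul_le_nsmul_right hcub 2
    have hPd : poleOrder (ι P) ≤ 2 • d.degree := by
      rw [hι, poleOrder_algebraMap]; exact nsmul_le_nsmul_right hle 2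
    have hC' : ∀ a, poleOrder (ι (C a)) ≤ 0 := by
      intro a
      rw [hι, poleOrder_algebraMap]
      exact (nsmul_le_nsmul_right degree_C_le 2).trans (by simp)
    have e3 : ι d * (ι (C 2) * A 1) = A 2 * (ι s * w + -(ι (C E₂.a₁) * ι P + ι (C E₂.a₃) * ι d)) := by
      rw [show (C 2 : K[X]) = 2 from rfl, map_ofNat]
      linear_combination e2 - ι (C E₂.a₁) * e1
    have e4 := congrArg poleOrder e3
    have hd2 : poleOrder (ι d) = 2 • d.degree := by rw [hι, poleOrder_algebraMap]
    have e5 : poleOrder (ι s * w + -(ι (C E₂.a₁) * ι P + ι (C E₂.a₃) * ι d)) ≤ 2 • d.degree := by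
      refine (poleOrder_add_le _ _).trans (max_le hsw ?_)
      rw [poleOrder_neg]
      refine (poleOrder_add_le _ _).trans (max_le ?_ ?_)
      · rw [poleOrder_mul, ← zero_add (2 • d.degree)]
        exact add_le_add (hC' _) hPd
      · rw [poleOrder_mul, ← zero_add (2 • d.degree)]
        exact add_le_add (hC' _) hd2.le
    have h2C : poleOrder (ι (C 2)) = 0 := by
      rw [hι, poleOrder_algebraMap, degree_C two_ne_zero, nsmul_zero]
    rw [poleOrder_mul, poleOrder_mul, poleOrder_mul, h2C, zero_add, hd2] at e4
    have e6 : 2 • d.degree + poleOrder (A 1) ≤ 2 • d.degree + poleOrder (A 2) := by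
      rw [e4, add_comm]
      gcongr
    rw [hdd] at e6
    have hne : (2 • (d.natDegree : WithBot ℕ)) ≠ ⊥ := by
      rw [nsmul_eq_mul, ← Nat.cast_mul]; exact WithBot.natCast_ne_bot _
    exact absurd (WithBot.le_of_add_le_add_left hne e6) (not_le.2 hlt)
  · rw [hθ, hι, ← IsScalarTower.algebraMap_apply, ← IsScalarTower.algebraMap_apply] at g1
    exact g1

end EllipticIsogeny

/-! ### The degree of the isogeny -/

namespace EllipticIsogeny

open Polynomial WeierstrassCurve.Affine.CoordinateRing IntermediateField

variable {K : Type*} [Field K]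

lemma algebraMap_functionField_injective (E : WeierstrassCurve K) :
    Function.Injective (algebraMap K[X] E.toAffine.FunctionField) := by
  rw [IsScalarTower.algebraMap_eq K[X] E.toAffine.CoordinateRing E.toAffine.FunctionField]
  exact (IsFractionRing.injective E.toAffine.CoordinateRing E.toAffine.FunctionField).comp
    (FaithfulSMul.algebraMap_injective _ _)

/-- The embedding `K(x) → K(E)`. -/
noncomputable def ratFuncHom (E : WeierstrassCurve K) : RatFunc K →ₐ[K] E.toAffine.FunctionField :=
  RatFunc.liftAlgHom (IsScalarTower.toAlgHom K K[X] E.toAffine.FunctionField)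
    (nonZeroDivisors_le_comap_nonZeroDivisors_of_injective _
      (algebraMap_functionField_injective E))

lemma ratFuncHom_algebraMap (E : WeierstrassCurve K) (p : K[X]) :
    ratFuncHom E (algebraMap K[X] (RatFunc K) p) = algebraMap K[X] _ p := by
  have := RatFunc.liftAlgHom_apply_div (IsScalarTower.toAlgHom K K[X] E.toAffine.FunctionField)
    (nonZeroDivisors_le_comap_nonZeroDivisors_of_injective _
      (algebraMap_functionField_injective E)) p 1
  rw [map_one, map_one, div_one, div_one] at this
  exact this

lemma ratFuncHom_X (E : WeierstrassCurve K) : ratFuncHom E RatFunc.X = xFun E := by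
  rw [← RatFunc.algebraMap_X, ratFuncHom_algebraMap]
  rfl

lemma map_ratFuncHom_top (E : WeierstrassCurve K) :
    (⊤ : IntermediateField K (RatFunc K)).map (ratFuncHom E) = K⟮xFun E⟯ := by
  rw [← RatFunc.adjoin_X, adjoin_map, Set.image_singleton, ratFuncHom_X]

lemma finrank_adjoin_xFun (E : WeierstrassCurve K) :
    Module.finrank K⟮xFun E⟯ E.toAffine.FunctionField = 2 := by
  rw [← map_ratFuncHom_top, ← AlgHom.fieldRange_eq_map]
  let _ : Algebra (RatFunc K) E.toAffine.FunctionField := (ratFuncHom E).toAlgebra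
  have : IsScalarTower K[X] (RatFunc K) E.toAffine.FunctionField :=
    IsScalarTower.of_algebraMap_eq fun p => (ratFuncHom_algebraMap E p).symm
  have h := IsFractionRing.finrank_eq K[X] (RatFunc K) E.toAffine.CoordinateRing
    E.toAffine.FunctionField
  rw [Module.finrank_eq_card_basis (Affine.CoordinateRing.basis E.toAffine), Fintype.card_fin] at h
  rw [← h]
  symm
  exact Algebra.finrank_eq_of_equiv_equiv
    (AlgEquiv.ofInjectiveField (ratFuncHom E)).toRingEquiv (RingEquiv.refl _) (by ext; rfl)

/-- The degree of `K(E₁)` over `K(φ^* x)` is computed through `K(x)` and through `φ^* K(E₂)`; each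
tower contributes a factor 2, which cancels. -/
lemma natDegree_eq_degree {E₁ E₂ : WeierstrassCurve K} (φ : Isogeny E₁ E₂) {f : RatFunc K}
    (hf : ratFuncHom E₁ f = φ.pullback (xFun E₂)) :
    max f.num.natDegree f.denom.natDegree = φ.degree := by
  have h1 : (K⟮f⟯).map (ratFuncHom E₁) = K⟮φ.pullback (xFun E₂)⟯ := by
    rw [adjoin_map, Set.image_singleton, hf]
  have h2 : (K⟮xFun E₂⟯).map φ.pullback = K⟮φ.pullback (xFun E₂)⟯ := by
    rw [adjoin_map, Set.image_singleton]
  have t1 := relfinrank_mul_finrank_top (map_mono (ratFuncHom E₁) (le_top (a := K⟮f⟯)))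
  have t2 := relfinrank_mul_finrank_top (map_mono φ.pullback (le_top (a := K⟮xFun E₂⟯)))
  rw [relfinrank_map_map, relfinrank_top_right, RatFunc.finrank_eq_max_natDegree, h1,
    map_ratFuncHom_top, finrank_adjoin_xFun] at t1
  rw [relfinrank_map_map, relfinrank_top_right, finrank_adjoin_xFun, h2,
    ← AlgHom.fieldRange_eq_map] at t2
  rw [← t2, mul_comm] at t1
  exact Nat.eq_of_mul_eq_mul_left two_pos t1

/-- The `j`-invariants of 2-isogenous elliptic curves are parametrized by the Hauptmodul
of `X₀(2)`. -/
theorem exists_hauptmodul [CharZero K] {E₁ E₂ : WeierstrassCurve K} [E₁.IsElliptic]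
    [E₂.IsElliptic] (φ : Isogeny E₁ E₂) (hφ : φ.degree = 2) :
    ∃ h : K, h ≠ 0 ∧ E₁.j * h = (h + 16) ^ 3 ∧ E₂.j * h ^ 2 = (h + 256) ^ 3 := by
  obtain ⟨P, s, d, hdeg, hd, hX, heq⟩ := exists_rational_form φ
  have hP : P ≠ 0 := by rintro rfl; simp at hdeg
  have hd' : algebraMap K[X] (RatFunc K) d ≠ 0 := RatFunc.algebraMap_ne_zero hd
  obtain ⟨f, hf⟩ : ∃ f, f = algebraMap K[X] (RatFunc K) P / algebraMap K[X] (RatFunc K) d :=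
    ⟨_, rfl⟩
  have hfX : ratFuncHom E₁ f = φ.pullback (xFun E₂) := by
    have hd'' : algebraMap K[X] E₁.toAffine.FunctionField d ≠ 0 := by
      rwa [Ne, map_eq_zero_iff _ (algebraMap_functionField_injective E₁)]
    rw [hf, map_div₀, ratFuncHom_algebraMap, ratFuncHom_algebraMap, ← hX, mul_div_cancel_left₀ _ hd'']
  have hmax := natDegree_eq_degree φ hfX
  rw [hφ] at hmax
  have hcross : P * f.denom = f.num * d := by
    have := RatFunc.num_div_denom f
    rw [hf, div_eq_div_iff (RatFunc.algebraMap_ne_zero (RatFunc.denom_ne_zero _)) hd'] at this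
    apply RatFunc.algebraMap_injective K
    rw [hf, map_mul, map_mul, ← this]
  have hcop := RatFunc.isCoprime_num_denom f
  -- `P / d` need not be reduced; the common factor `g` survives in the relation only as the square
  -- `g ^ 2`.
  obtain ⟨g, hg⟩ : f.denom ∣ d := hcop.symm.dvd_of_dvd_mul_left ⟨P, by rw [← hcross, mul_comm]⟩
  have hg0 : g ≠ 0 := by rintro rfl; exact hd (by rw [hg, mul_zero])
  have hPg : P = f.num * g := by
    apply mul_right_cancel₀ (RatFunc.denom_ne_zero f)
    rw [hcross, hg]; ring
  have hnum : f.num ≠ 0 := by rintro h; exact hP (by rw [hPg, h, zero_mul])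
  have hlt : f.denom.natDegree < f.num.natDegree := by
    have := (natDegree_lt_natDegree_iff hd).2 hdeg
    rw [hPg, natDegree_mul hnum hg0] at this
    rw [hg, natDegree_mul (RatFunc.denom_ne_zero f) hg0] at this
    omega
  refine exists_hauptmodul_of_mul_sq_eq E₁ E₂ (s := s) hg0 hcop (RatFunc.monic_denom f) (by omega)
    (by omega) ?_
  apply mul_left_cancel₀ hg0
  rw [hPg] at heq
  nth_rw 1 [hg] at heq
  rw [hg] at heq
  linear_combination heq

end EllipticIsogeny

/-! ### Integer-valued valuations -/

section Valuation

variable (O : Type*) {K : Type*} [CommRing O] [IsDomain O] [IsDiscreteValuationRing O] [Field K]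
  [Algebra O K] [IsFractionRing O K]

/-- The integer-valued normalized valuation, with the junk value `0` at `0`. -/
noncomputable def intVal (x : K) : ℤ :=
  -WithZero.log ((IsDiscreteValuationRing.maximalIdeal O).valuation K x)

lemma normVal_zero : normVal O (0 : K) = ⊤ := by simp [normVal]

lemma normVal_of_ne_zero {x : K} (hx : x ≠ 0) : normVal O x = (intVal O x : WithTop ℤ) := by
  rw [normVal, if_neg hx]; rfl

variable {O}

lemma valuation_ne_zero {x : K} (hx : x ≠ 0) :
    (IsDiscreteValuationRing.maximalIdeal O).valuation K x ≠ 0 := by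
  rwa [Ne, Valuation.zero_iff]

lemma intVal_mul {x y : K} (hx : x ≠ 0) (hy : y ≠ 0) :
    intVal O (x * y) = intVal O x + intVal O y := by
  rw [intVal, intVal, intVal, map_mul, WithZero.log_mul (valuation_ne_zero hx)
    (valuation_ne_zero hy)]
  ring

lemma intVal_pow (x : K) (n : ℕ) : intVal O (x ^ n) = n * intVal O x := by
  rw [intVal, intVal, map_pow, WithZero.log_pow]
  simp

lemma intVal_neg (x : K) : intVal O (-x) = intVal O x := by
  rw [intVal, intVal, Valuation.map_neg]

lemma intVal_inv (x : K) : intVal O x⁻¹ = -intVal O x := by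
  rw [intVal, intVal, map_inv₀, WithZero.log_inv]

lemma valuation_lt_one_iff {x : K} (hx : x ≠ 0) :
    (IsDiscreteValuationRing.maximalIdeal O).valuation K x < 1 ↔ 0 < intVal O x := by
  rw [intVal, ← WithZero.log_lt_log (valuation_ne_zero hx) one_ne_zero, WithZero.log_one]
  omega

lemma valuation_le_one_iff {x : K} (hx : x ≠ 0) :
    (IsDiscreteValuationRing.maximalIdeal O).valuation K x ≤ 1 ↔ 0 ≤ intVal O x := by
  rw [intVal, ← WithZero.log_le_log (valuation_ne_zero hx) one_ne_zero, WithZero.log_one]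
  omega

lemma intVal_add_eq_left {x y : K} (hx : x ≠ 0) (hy : y ≠ 0) (h : intVal O x < intVal O y) :
    x + y ≠ 0 ∧ intVal O (x + y) = intVal O x := by
  have h1 : (IsDiscreteValuationRing.maximalIdeal O).valuation K y <
      (IsDiscreteValuationRing.maximalIdeal O).valuation K x := by
    rw [← WithZero.log_lt_log (valuation_ne_zero hy) (valuation_ne_zero hx)]
    rw [intVal, intVal] at h
    omega
  have h2 := Valuation.map_add_eq_of_lt_right _ h1
  rw [add_comm] at h2
  constructor
  · intro h0
    rw [h0, map_zero] at h2
    exact valuation_ne_zero hx h2.symm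
  · rw [intVal, h2]; rfl

lemma le_intVal_add {x y : K} (hx : x ≠ 0) (hxy : x + y ≠ 0)
    (h : intVal O x = intVal O y) : intVal O x ≤ intVal O (x + y) := by
  by_contra! hlt
  have hx' : -x ≠ 0 := neg_ne_zero.2 hx
  have := (intVal_add_eq_left (O := O) hxy hx' (by rwa [intVal_neg])).2
  rw [add_neg_cancel_comm] at this
  omega

/-- The possible valuations of a sum. -/
lemma intVal_add_cases {x y : K} (hx : x ≠ 0) (hy : y ≠ 0) :
    (intVal O x < intVal O y ∧ x + y ≠ 0 ∧ intVal O (x + y) = intVal O x) ∨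
    (intVal O y < intVal O x ∧ x + y ≠ 0 ∧ intVal O (x + y) = intVal O y) ∨
    (intVal O x = intVal O y ∧ (x + y ≠ 0 → intVal O x ≤ intVal O (x + y))) := by
  rcases lt_trichotomy (intVal O x) (intVal O y) with h | h | h
  · exact Or.inl ⟨h, intVal_add_eq_left hx hy h⟩
  · exact Or.inr (Or.inr ⟨h, fun hxy => le_intVal_add hx hxy h⟩)
  · refine Or.inr (Or.inl ⟨h, ?_⟩)
    rw [add_comm]
    exact intVal_add_eq_left hy hx h

lemma intVal_two_pos [CharZero K] [CharP (IsLocalRing.ResidueField O) 2] : 0 < intVal O (2 : K) := by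
  rw [← valuation_lt_one_iff two_ne_zero, ← map_ofNat (algebraMap O K) 2,
    IsDedekindDomain.HeightOneSpectrum.valuation_lt_one_iff_mem]
  change (2 : O) ∈ IsLocalRing.maximalIdeal O
  rw [← IsLocalRing.residue_eq_zero_iff, map_ofNat]
  exact CharP.cast_eq_zero _ 2

/-! ### Embeddings of `ℚ₂` into `K` -/

section Padic

lemma PadicInt.exists_pow_three_eq (z : ℤ_[2]ˣ) : ∃ w : ℤ_[2]ˣ, w ^ 3 = z := by
  have hz : ‖(1 : ℤ_[2]) - z‖ < 1 := by
    rw [← PadicInt.mem_nonunits, ← IsLocalRing.mem_maximalIdeal, ← PadicInt.ker_toZMod,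
      RingHom.mem_ker, map_sub, map_one]
    have : (PadicInt.toZMod (z : ℤ_[2])) ≠ 0 := (z.isUnit.map PadicInt.toZMod).ne_zero
    generalize PadicInt.toZMod (z : ℤ_[2]) = t at this ⊢
    revert t; decide
  have h3 : ‖(3 : ℤ_[2])‖ = 1 := by
    have : ‖((3 : ℤ) : ℤ_[2])‖ = 1 := by
      rw [PadicInt.norm_intCast_eq_one_iff]; norm_num
    simpa using this
  -- At `1` the polynomial `X³ - z` is `≡ 0` modulo `2` and its derivative `3` is a unit.
  obtain ⟨w, hw, -⟩ := hensels_lemma (p := 2) (R := ℤ_[2])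
    (F := (Polynomial.X ^ 3 - Polynomial.C (z : ℤ_[2]))) (a := 1) (by
      have h21 : (2 + 1 : ℤ_[2]) = 3 := by norm_num
      simp [h21, h3, hz])
  have hw : w ^ 3 = z := by simpa [sub_eq_zero] using hw
  have hu : IsUnit w := by
    rw [← isUnit_pow_iff (n := 3) (by norm_num), hw]; exact z.isUnit
  exact ⟨hu.unit, Units.ext (by simpa using hw)⟩

variable (O) in
/-- Units of `ℤ₂` are infinitely divisible by `3`, so every discrete valuation is trivial
on them. -/
lemma intVal_padicInt_unit (f : ℚ_[2] →+* K) (z : ℤ_[2]ˣ) :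
    intVal O (f ((z : ℤ_[2]) : ℚ_[2])) = 0 := by
  obtain ⟨n, hn⟩ : ∃ n, n = (intVal O (f ((z : ℤ_[2]) : ℚ_[2]))).natAbs := ⟨_, rfl⟩
  induction n using Nat.strong_induction_on generalizing z with
  | _ n ih =>
    -- A cube root divides the absolute value of the valuation by 3, so descent ends only at `0`. No
    -- continuity of `f` is needed.
    obtain ⟨w, rfl⟩ := PadicInt.exists_pow_three_eq z
    rw [Units.val_pow_eq_pow_val, PadicInt.coe_pow, map_pow, intVal_pow] at hn ⊢
    by_contra hne
    have := ih _ (by omega) w rfl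
    rw [this] at hne
    exact hne rfl

variable (O) in
lemma intVal_padicInt [CharZero K] (f : ℚ_[2] →+* K) {x : ℤ_[2]} (hx : x ≠ 0) :
    intVal O (f (x : ℚ_[2])) = x.valuation * intVal O (2 : K) := by
  conv_lhs => rw [PadicInt.unitCoeff_spec hx]
  have h1 : f ((PadicInt.unitCoeff hx : ℤ_[2]) : ℚ_[2]) ≠ 0 := by
    rw [Ne, map_eq_zero, PadicInt.coe_eq_zero]
    exact (PadicInt.unitCoeff hx).ne_zero
  rw [PadicInt.coe_mul, map_mul, PadicInt.coe_pow, map_pow, intVal_mul h1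
    (by simp), intVal_padicInt_unit, intVal_pow,
    zero_add, PadicInt.coe_natCast, map_natCast, Nat.cast_ofNat]

/-- The residue field of `ℚ₂` has two elements. -/
lemma intVal_sub_one_pos [CharZero K] [CharP (IsLocalRing.ResidueField O) 2] (f : ℚ_[2] →+* K) {c : ℚ_[2]}
    (hc : c ≠ 0) (h : intVal O (f c) = 0) (h1 : c ≠ 1) : 0 < intVal O (f c - 1) := by
  have h2 := intVal_two_pos (O := O) (K := K)
  have key : ∀ x : ℤ_[2], x ≠ 0 → intVal O (f x) = 0 → IsUnit x := by
    intro x hx h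
    rw [intVal_padicInt O f hx] at h
    have h0 : x.valuation = 0 := by
      rcases mul_eq_zero.1 h with h | h
      · exact_mod_cast h
      · omega
    rw [PadicInt.isUnit_iff, PadicInt.norm_eq_zpow_neg_valuation hx, h0]
    simp
  obtain ⟨z, rfl⟩ : ∃ z : ℤ_[2]ˣ, c = ((z : ℤ_[2]) : ℚ_[2]) := by
    rcases le_total ‖c‖ 1 with hle | hle
    · have hu := key ⟨c, hle⟩ (fun h0 => hc (PadicInt.coe_eq_zero.2 h0)) h
      exact ⟨hu.unit, rfl⟩
    · have hle' : ‖c⁻¹‖ ≤ 1 := by rw [norm_inv]; exact inv_le_one_of_one_le₀ hle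
      have hu := key ⟨c⁻¹, hle'⟩ (fun h0 => inv_ne_zero hc (PadicInt.coe_eq_zero.2 h0)) (by
        change intVal O (f c⁻¹) = 0
        rw [map_inv₀, intVal_inv, h, neg_zero])
      have hn := PadicInt.isUnit_iff.1 hu
      have hn' : ‖c⁻¹‖ = 1 := hn
      have hnc : ‖c‖ = 1 := by rwa [norm_inv, inv_eq_one] at hn'
      obtain ⟨x, hx⟩ : ∃ x : ℤ_[2], (x : ℚ_[2]) = c := ⟨⟨c, hnc.le⟩, rfl⟩
      have hu' : IsUnit x := PadicInt.isUnit_iff.2 (by rw [PadicInt.norm_def, hx, hnc])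
      exact ⟨hu'.unit, hx.symm⟩
  have hmem : 2 ∣ (z : ℤ_[2]) - 1 := by
    have := PadicInt.norm_lt_one_iff_dvd (p := 2) ((z : ℤ_[2]) - 1)
    rw [Nat.cast_ofNat] at this
    rw [← this, ← PadicInt.mem_nonunits, ← IsLocalRing.mem_maximalIdeal, ← PadicInt.ker_toZMod,
      RingHom.mem_ker, map_sub, map_one]
    have : (PadicInt.toZMod (z : ℤ_[2])) ≠ 0 := (z.isUnit.map PadicInt.toZMod).ne_zero
    generalize PadicInt.toZMod (z : ℤ_[2]) = t at this ⊢
    revert t; decide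
  obtain ⟨y, hy⟩ := hmem
  have hy' : ((z : ℤ_[2]) : ℚ_[2]) - 1 = 2 * (y : ℚ_[2]) := by
    have := congrArg (fun t : ℤ_[2] => (t : ℚ_[2])) hy
    have h20 : ((2 : ℤ_[2]) : ℚ_[2]) = 2 := rfl
    simpa [h20] using this
  have hy0 : y ≠ 0 := by
    rintro rfl
    apply h1
    simpa [sub_eq_zero] using hy'
  have hfy : f (y : ℚ_[2]) ≠ 0 := by rwa [Ne, map_eq_zero, PadicInt.coe_eq_zero]
  rw [← map_one f, ← map_sub, hy', map_mul, map_ofNat, intVal_mul two_ne_zero hfy,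
    intVal_padicInt O f hy0]
  positivity

end Padic

/-- If `c t = (16 t + 1)³` with `t` a unit and `c ≡ 1`, then `t ≡ -1 ≡ 1`. -/
lemma intVal_add_one_pos [CharZero K] [CharP (IsLocalRing.ResidueField O) 2] {c t : K} (ht0 : t ≠ 0)
    (ht : intVal O t = 0) (ht1 : t + 1 ≠ 0) (hc : c ≠ 1 → 0 < intVal O (c - 1))
    (h : c * t = (16 * t + 1) ^ 3) : 0 < intVal O (t + 1) := by
  obtain ⟨t', rfl⟩ := IsDiscreteValuationRing.exists_lift_of_le_one
    ((valuation_le_one_iff (O := O) ht0).2 ht.ge)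
  have hc' : (IsDiscreteValuationRing.maximalIdeal O).valuation K (c - 1) < 1 := by
    by_cases h1 : c = 1
    · rw [h1, sub_self, map_zero]; exact zero_lt_one
    · exact (valuation_lt_one_iff (sub_ne_zero.2 h1)).2 (hc h1)
  obtain ⟨c', hc''⟩ := IsDiscreteValuationRing.exists_lift_of_le_one hc'.le
  rw [← hc'', IsDedekindDomain.HeightOneSpectrum.valuation_lt_one_iff_mem] at hc'
  have h2 : (2 : O) ∈ (IsDiscreteValuationRing.maximalIdeal O).asIdeal := by
    rw [← IsDedekindDomain.HeightOneSpectrum.valuation_lt_one_iff_mem (K := K)]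
    change (IsDiscreteValuationRing.maximalIdeal O).valuation K (algebraMap O K 2) < 1
    rw [map_ofNat, valuation_lt_one_iff two_ne_zero]
    exact intVal_two_pos
  -- Expand `(16 t + 1)³`, substitute `c = 1 + c'`, and isolate `t + 1`: everything else is
  -- divisible by `2` or by `c'`.
  have hsum : algebraMap O K t' + 1 = algebraMap O K
      ((1 + 24 * t' + 384 * t' ^ 2 + 2048 * t' ^ 3) * 2 - t' * c') := by
    simp only [map_sub, map_mul, map_add, map_pow, map_one, map_ofNat]
    rw [hc'']
    linear_combination h
  rw [← valuation_lt_one_iff ht1, hsum,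
    IsDedekindDomain.HeightOneSpectrum.valuation_lt_one_iff_mem]
  exact Ideal.sub_mem _ (Ideal.mul_mem_left _ _ h2) (Ideal.mul_mem_left _ _ hc')

end Valuation

/-! ### Valuations of the two `j`-invariants -/

section Hauptmodul

variable {O K : Type*} [CommRing O] [IsDomain O] [IsDiscreteValuationRing O] [Field K]
  [Algebra O K] [IsFractionRing O K]

lemma normVal_eq_of_mul_pow_eq {j h s : K} {k : ℕ} (hh : h ≠ 0) (hs : s ≠ 0)
    (e : j * h ^ k = s ^ 3) :
    normVal O j = ((3 * intVal O s - k * intVal O h : ℤ) : WithTop ℤ) := by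
  have hj : j ≠ 0 := by
    rintro rfl
    rw [zero_mul] at e
    exact pow_ne_zero 3 hs e.symm
  have := congrArg (intVal O) e
  rw [intVal_mul hj (pow_ne_zero k hh), intVal_pow, intVal_pow] at this
  rw [normVal_of_ne_zero O hj]
  congr 1
  push_cast at this
  linarith

/-- With `e = v(2)` and `m = v(h)`, equal positive valuations force `m = 6e`, and `0 < v(j₁) <
v(j₂)` forces `6e < m < 12e` when `j₂ ≠ 0`. There `v(j₁) = 12e - m`, and (a), (b), (c) are `m > 8e`,
`m < 8e`, `m = 8e`. -/
lemma hauptmodul_valuations [CharZero K] [CharP (IsLocalRing.ResidueField O) 2] {j₁ j₂ h : K} (hh : h ≠ 0)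
    (e₁ : j₁ * h = (h + 16) ^ 3) (e₂ : j₂ * h ^ 2 = (h + 256) ^ 3) :
    (normVal O j₁ = normVal O j₂ → 0 < normVal O j₁ →
      normVal O j₁ = 6 • normVal O (2 : K) ∧ normVal O j₂ = 6 • normVal O (2 : K)) ∧
    (0 < normVal O j₁ → normVal O j₁ < normVal O j₂ →
      normVal O j₁ < 6 • normVal O (2 : K) ∧
      (normVal O j₁ < 4 • normVal O (2 : K) → normVal O j₂ = 2 • normVal O j₁) ∧
      (4 • normVal O (2 : K) < normVal O j₁ → normVal O j₁ < 6 • normVal O (2 : K) →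
        normVal O j₂ = 12 • normVal O (2 : K) - normVal O j₁) ∧
      (normVal O j₁ = 4 • normVal O (2 : K) → j₂ ≠ 0 →
        (intVal O h = 8 * intVal O (2 : K) ∧ h + 256 ≠ 0 ∧
          normVal O j₂ = ((3 * intVal O (h + 256) - 16 * intVal O (2 : K) : ℤ) : WithTop ℤ) ∧
          8 * intVal O (2 : K) ≤ intVal O (h + 256)))) := by
  have he := intVal_two_pos (O := O) (K := K)
  have c₁ := intVal_add_cases (O := O) hh (show (16 : K) ≠ 0 by norm_num)
  have c₂ := intVal_add_cases (O := O) hh (show (256 : K) ≠ 0 by norm_num)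
  have v16 : intVal O (16 : K) = 4 * intVal O (2 : K) := by
    rw [show (16 : K) = 2 ^ 4 by norm_num, intVal_pow]; rfl
  have v256 : intVal O (256 : K) = 8 * intVal O (2 : K) := by
    rw [show (256 : K) = 2 ^ 8 by norm_num, intVal_pow]; rfl
  rw [v16] at c₁
  rw [v256] at c₂
  rw [normVal_of_ne_zero O (two_ne_zero' K)]
  have n₁ := fun hs => normVal_eq_of_mul_pow_eq (O := O) (k := 1) hh hs (by rw [pow_one, e₁])
  have n₂ := fun hs => normVal_eq_of_mul_pow_eq (O := O) hh hs e₂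
  have z₁ : h + 16 = 0 → normVal O j₁ = ⊤ := by
    intro h0
    rw [h0, zero_pow three_ne_zero, mul_eq_zero, or_iff_left hh] at e₁
    rw [e₁, normVal_zero]
  have z₂ : h + 256 = 0 → j₂ = 0 := by
    intro h0
    rw [h0, zero_pow three_ne_zero, mul_eq_zero, or_iff_left (pow_ne_zero 2 hh)] at e₂
    exact e₂
  generalize intVal O (2 : K) = e at *
  -- The zeros `h = -16` and `h = -256` are treated apart: there `j₁` or `j₂` is `0`, with infinite
  -- valuation.
  by_cases h₁ : h + 16 = 0
  · have t₁ := z₁ h₁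
    have h₂ : h + 256 ≠ 0 := by
      intro h₂
      have : (240 : K) = 0 := by linear_combination h₂ - h₁
      norm_num at this
    rw [t₁, n₂ h₂]
    simp only [← WithTop.coe_nsmul, WithTop.top_ne_coe, not_top_lt, false_imp_iff, imp_true_iff,
      and_self]
  by_cases h₂ : h + 256 = 0
  · have t₂ := z₂ h₂
    rw [n₁ h₁, t₂, normVal_zero]
    simp only [h₁, h₂, ne_eq, not_false_eq_true, true_and, not_true_eq_false, false_imp_iff,
      eq_self, false_and, and_false, false_or, and_true] at c₁ c₂
    simp only [← WithTop.coe_nsmul, WithTop.coe_ne_top, WithTop.coe_lt_coe, WithTop.coe_pos,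
      nsmul_eq_mul, Nat.cast_ofNat, Nat.cast_one, false_imp_iff, true_and, not_true_eq_false,
      ne_eq, imp_true_iff, and_true]
    refine fun h0 _ => ⟨by omega, fun h => absurd h (by omega), fun h => absurd h (by omega)⟩
  rw [n₁ h₁, n₂ h₂]
  simp only [h₁, h₂, ne_eq, not_false_eq_true, true_and, forall_const] at c₁ c₂
  have hsub : ∀ a b : ℤ, ((a : WithTop ℤ) - (b : WithTop ℤ)) = ((a - b : ℤ) : WithTop ℤ) :=
    fun _ _ => rfl
  simp only [← WithTop.coe_nsmul, hsub, WithTop.coe_inj, WithTop.coe_lt_coe, WithTop.coe_pos,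
    nsmul_eq_mul, Nat.cast_ofNat, Nat.cast_one]
  refine ⟨fun h0 h1 => ?_, fun h0 h1 => ⟨?_, fun h2 => ?_, fun h2 h3 => ?_, fun h2 _ =>
    ⟨?_, h₂, ?_, ?_⟩⟩⟩ <;> omega

end Hauptmodul

theorem proposition3p8 {O K : Type*} [CommRing O] [IsDomain O] [IsDiscreteValuationRing O]
    [HenselianLocalRing O] [IsAlgClosed (IsLocalRing.ResidueField O)]
    [CharP (IsLocalRing.ResidueField O) 2]
    [Field K] [CharZero K] [Algebra O K] [IsFractionRing O K]
    (E₁ E₂ : WeierstrassCurve K) [E₁.IsElliptic] [E₂.IsElliptic]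
    (φ : EllipticIsogeny.Isogeny E₁ E₂) (hφ : φ.degree = 2) :
    (normVal O E₁.j = normVal O E₂.j → 0 < normVal O E₁.j →
      normVal O E₁.j = 6 • normVal O (2 : K) ∧ normVal O E₂.j = 6 • normVal O (2 : K)) ∧
    (0 < normVal O E₁.j → normVal O E₁.j < normVal O E₂.j →
      normVal O E₁.j < 6 • normVal O (2 : K) ∧
      (normVal O E₁.j < 4 • normVal O (2 : K) → normVal O E₂.j = 2 • normVal O E₁.j) ∧
      (4 • normVal O (2 : K) < normVal O E₁.j → normVal O E₁.j < 6 • normVal O (2 : K) →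
        normVal O E₂.j = 12 • normVal O (2 : K) - normVal O E₁.j) ∧
      (normVal O E₁.j = 4 • normVal O (2 : K) → E₂.j ≠ 0 →
        ∃ r : ℕ, normVal O E₂.j = 8 • normVal O (2 : K) + ((3 * (r : ℤ) : ℤ) : WithTop ℤ))) ∧
    (∀ e : K ≃+* maxUnramified,
      e E₁.j ∈ Set.range (algebraMap ℚ_[2] maxUnramified) →
      e E₂.j ∈ Set.range (algebraMap ℚ_[2] maxUnramified) →
      normVal O E₁.j = 4 • normVal O (2 : K) → normVal O E₁.j < normVal O E₂.j → E₂.j ≠ 0 →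
        ∃ r : ℕ, 1 ≤ r ∧
          normVal O E₂.j = 8 • normVal O (2 : K) + ((3 * (r : ℤ) : ℤ) : WithTop ℤ)) := by
  obtain ⟨h, hh, e₁, e₂⟩ := EllipticIsogeny.exists_hauptmodul φ hφ
  obtain ⟨hi, hii⟩ := hauptmodul_valuations (O := O) hh e₁ e₂
  have h2 := intVal_two_pos (O := O) (K := K)
  have n2 := normVal_of_ne_zero O (two_ne_zero' K)
  refine ⟨hi, fun h0 hlt => ?_, fun e hj₁ _ hv hlt hj₂ => ?_⟩
  · obtain ⟨ha, hb, hc, hd⟩ := hii h0 hlt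
    refine ⟨ha, hb, hc, fun hv hj₂ => ?_⟩
    obtain ⟨-, -, hn, hle⟩ := hd hv hj₂
    refine ⟨(intVal O (h + 256) - 8 * intVal O (2 : K)).toNat, ?_⟩
    rw [hn, n2, ← WithTop.coe_nsmul, ← WithTop.coe_add, WithTop.coe_inj, nsmul_eq_mul]
    push_cast
    omega
  · have h0 : 0 < normVal O E₁.j := by
      rw [hv, n2, ← WithTop.coe_nsmul, WithTop.coe_pos, nsmul_eq_mul]
      push_cast
      omega
    obtain ⟨hm, hne, hn, -⟩ := (hii h0 hlt).2.2.2 hv hj₂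
    have h256 : (256 : K) ≠ 0 := by norm_num
    have v16 : intVal O (16 : K) = 4 * intVal O (2 : K) := by
      rw [show (16 : K) = 2 ^ 4 by norm_num, intVal_pow]; rfl
    have v256 : intVal O (256 : K) = 8 * intVal O (2 : K) := by
      rw [show (256 : K) = 2 ^ 8 by norm_num, intVal_pow]; rfl
    have ht : h / 256 * 256 = h := div_mul_cancel₀ h h256
    have ht0 : h / 256 ≠ 0 := div_ne_zero hh h256
    have ht1 : h / 256 + 1 ≠ 0 := by
      intro h0
      exact hne (by linear_combination 256 * h0)
    have vt : intVal O (h / 256) = 0 := by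
      have := intVal_mul (O := O) ht0 h256
      rw [ht] at this
      omega
    have vB : intVal O (h + 256) = intVal O (h / 256 + 1) + 8 * intVal O (2 : K) := by
      rw [← v256, ← intVal_mul ht1 h256, add_mul, ht, one_mul]
    have hj0 : E₁.j ≠ 0 := by
      intro h0
      rw [h0, normVal_zero, n2] at hv
      exact WithTop.top_ne_coe hv
    have vj : intVal O E₁.j = 4 * intVal O (2 : K) := by
      rw [normVal_of_ne_zero O hj0, n2, ← WithTop.coe_nsmul, WithTop.coe_inj, nsmul_eq_mul] at hv
      exact_mod_cast hv
    obtain ⟨c, hc⟩ := hj₁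
    -- `e` is an abstract ring isomorphism, not assumed to respect valuations; only the resulting
    -- embedding of `ℚ₂` is used.
    obtain ⟨f, hf⟩ : ∃ f, f = (e.symm : maxUnramified →+* K).comp (algebraMap ℚ_[2] maxUnramified) :=
      ⟨_, rfl⟩
    have hfc : f c = E₁.j := by
      rw [hf, RingHom.comp_apply, hc]
      exact e.symm_apply_apply _
    have hc0 : c ≠ 0 := by
      rintro rfl
      exact hj0 (by rw [← hfc, map_zero])
    have hfc' : f (c / 16) * 16 = E₁.j := by
      rw [map_div₀, hfc, map_ofNat]
      exact div_mul_cancel₀ _ (by norm_num)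
    have hfc0 : f (c / 16) ≠ 0 := by
      intro h0
      exact hj0 (by rw [← hfc', h0, zero_mul])
    have vc : intVal O (f (c / 16)) = 0 := by
      have := intVal_mul (O := O) hfc0 (show (16 : K) ≠ 0 by norm_num)
      rw [hfc'] at this
      omega
    have hpos : 0 < intVal O (h / 256 + 1) := by
      refine intVal_add_one_pos (c := f (c / 16)) ht0 vt ht1 (fun h1 => ?_) ?_
      · refine intVal_sub_one_pos f (div_ne_zero hc0 (by norm_num)) vc ?_
        intro h0
        exact h1 (by rw [h0, map_one])
      · rw [← hfc', ← ht] at e₁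
        linear_combination (1 / 4096) * e₁
    -- `r = v(t + 1)` for `t = h / 256`, since `v(j₂) = 3 (v(t + 1) + 8 v(2)) - 16 v(2)`.
    refine ⟨(intVal O (h / 256 + 1)).toNat, by omega, ?_⟩
    rw [hn, n2, ← WithTop.coe_nsmul, ← WithTop.coe_add, WithTop.coe_inj, nsmul_eq_mul, vB]
    push_cast
    omega
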